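/- Let $r,c\ge 1$ be integers and $n=rc$. Let $\mathrm{SYT}(R\times C)$ be the set of standard Young tableaux of rectangular shape with $R$ rows and $C$ columns (entries $1,\dots,RC$). Stacking. For $P,Q\in\mathrm{SYT}(r\times c)$ let $\mathrm{stack}(P,Q)\in\mathrm{SYT}(2r\times c)$ be the tableau obtained by adding $n$ to every entry of $Q$ and placing the result below $P$. Let $\mathrm{SYT}^{\mathrm{stacked}}(2r\times c)$ be the set of all tableaux $\mathrm{stack}(P,Q)$ with $P,Q\in\mathrm{SYT}(r\times c)$. Promotion permutations. For a filling $T$ of the $R\times C$ rectangle with labels $a<a+1<\dots<a+RC-1$, strictly increasing along rows and down columns, its gromotion $\mathcal G(T)$ is obtained by deleting the smallest label $a$ from the northwest corner, repeatedly sliding into the empty cell the smaller of the entries immediately to its right and immediately below it (jeu de taquin) until the empty cell is the southeast corner, and filling that corner with $a+RC$. For $T\in\mathrm{SYT}(R\times C)$ and $1\le i\le R-1$, the promotion permutation $\mathrm{prom}_i(T)\in\mathfrak S_{RC}$ is the permutation of $\{1,\dots,RC\}$ sending $k$ to the residue in $\{1,\dots,RC\}$ modulo $RC$ of the unique entry that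 slides (upwards, from row $i+1$) into row $i$ when $\mathcal G^{k}(T)$ is computed from $\mathcal G^{k-1}(T)$. Crossings and nestings. Let $\rho$ be a fixed-point-free involution of $\{1,\dots,2n\}$. A $k$-crossing of $\rho$ is a collection of $k$ two-cycles $(i_1\ j_1),\dots,(i_k\ j_k)$ of $\rho$ with $i_1<\dots<i_k<j_1<\dots<j_k$; a $k$-nesting is a collection of $k$ two-cycles with $i_1<\dots<i_k<j_k<\dots<j_1$. The crossing number (nesting number) of $\rho$ is the maximum $k$ for which $\rho$ has a $k$-crossing ($k$-nesting). Claim. The map $\mathrm{SYT}^{\mathrm{stacked}}(2r\times c)\to\mathfrak S_{2n}$, $S\mapsto\mathrm{prom}_r(S)$, is well defined and injective. Its image is exactly the set of fixed-point-free involutions $\rho\in\mathfrak S_{2n}$ such that every two-cycle of $\rho$ is of the form $(a\ b)$ with $a\in\{1,\dots,n\}$ and $b\in\{n+1,\dots,2n\}$, the crossing number of $\rho$ is $r$, and the nesting number of $\rho$ is $c$. -/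

import Mathlib

/-- A standard Young tableau of shape `μ`: a semistandard tableau in which each of the numbers
`1, …, |μ|` occurs exactly once (so rows and columns are strictly increasing). As in Mathlib,
rows and columns are indexed from `0`, and entries outside of `μ` are `0`. -/
structure StandardYoungTableau (μ : YoungDiagram) extends SemistandardYoungTableau μ where
  bijOn' : Set.BijOn (fun p : ℕ × ℕ => entry p.1 p.2) (μ.cells : Set (ℕ × ℕ)) (Set.Icc 1 μ.card)

/-- The rectangular Young diagram with `R` rows and `C` columns. -/
def rectDiagram (R C : ℕ) : YoungDiagram where
  cells := Finset.range R ×ˢ Finset.range C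
  isLowerSet := by
    rintro ⟨a, b⟩ ⟨a', b'⟩ h hab
    simp only [Prod.mk_le_mk] at h
    simp only [Finset.coe_product, Finset.coe_range, Set.mem_prod, Set.mem_Iio] at hab ⊢
    omega

theorem mem_rectDiagram {R C : ℕ} {p : ℕ × ℕ} :
    p ∈ rectDiagram R C ↔ p.1 < R ∧ p.2 < C := by
  rw [← YoungDiagram.mem_cells]
  simp [rectDiagram]

theorem card_rectDiagram (R C : ℕ) : (rectDiagram R C).card = R * C := by
  simp [YoungDiagram.card, rectDiagram]

/-- `SYT(R × C)`. -/
abbrev RectSYT (R C : ℕ) : Type := StandardYoungTableau (rectDiagram R C)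

/-- The entries of `stack(P, Q)`: the rows of `P`, and below them the rows of `Q` with `r * c`
added to every entry. -/
def stackEntry {r c : ℕ} (P Q : RectSYT r c) (i j : ℕ) : ℕ :=
  if i < r then P.entry i j
  else if i < 2 * r ∧ j < c then Q.entry (i - r) j + r * c
  else 0

/-- The entries of a rectangular standard tableau lie between `1` and `r * c`. -/
theorem RectSYT.entry_mem {r c : ℕ} (P : RectSYT r c) {i j : ℕ} (hi : i < r) (hj : j < c) :
    1 ≤ P.entry i j ∧ P.entry i j ≤ r * c := by
  have h := P.bijOn'.mapsTo (x := (i, j))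
    ((YoungDiagram.mem_cells _).2 (mem_rectDiagram.2 ⟨hi, hj⟩))
  rw [card_rectDiagram] at h
  exact h

theorem stackEntry_top {r c : ℕ} (P Q : RectSYT r c) {i j : ℕ} (hi : i < r) :
    stackEntry P Q i j = P.entry i j := by
  simp [stackEntry, hi]

theorem stackEntry_bot {r c : ℕ} (P Q : RectSYT r c) {i j : ℕ} (hi : r ≤ i) (hi' : i < 2 * r)
    (hj : j < c) : stackEntry P Q i j = Q.entry (i - r) j + r * c := by
  simp [stackEntry, not_lt.2 hi, hi', hj]

/-- The stacked tableau `stack(P, Q)`, with `2 * r` rows and `c` columns. -/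
def stack {r c : ℕ} (P Q : RectSYT r c) : RectSYT (2 * r) c where
  entry := stackEntry P Q
  row_weak' := by
    intro i j1 j2 hj h
    obtain ⟨hi, hj2⟩ : i < 2 * r ∧ j2 < c := mem_rectDiagram.1 h
    rcases lt_or_ge i r with h1 | h1
    · rw [stackEntry_top _ _ h1, stackEntry_top _ _ h1]
      exact P.row_weak' hj (mem_rectDiagram.2 ⟨h1, hj2⟩)
    · have h2 : i - r < r := by omega
      rw [stackEntry_bot _ _ h1 hi hj2, stackEntry_bot _ _ h1 hi (hj.trans hj2)]
      have := Q.row_weak' (i := i - r) hj (mem_rectDiagram.2 ⟨h2, hj2⟩)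
      omega
  col_strict' := by
    intro i1 i2 j hi h
    obtain ⟨hi2, hj⟩ : i2 < 2 * r ∧ j < c := mem_rectDiagram.1 h
    rcases lt_or_ge i2 r with h2 | h2
    · rw [stackEntry_top _ _ h2, stackEntry_top _ _ (hi.trans h2)]
      exact P.col_strict' hi (mem_rectDiagram.2 ⟨h2, hj⟩)
    · have h3 : i2 - r < r := by omega
      rw [stackEntry_bot _ _ h2 hi2 hj]
      rcases lt_or_ge i1 r with h1 | h1
      · rw [stackEntry_top _ _ h1]
        have := P.entry_mem h1 hj
        have := Q.entry_mem h3 hj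
        omega
      · rw [stackEntry_bot _ _ h1 (hi.trans hi2) hj]
        have h4 : i1 - r < i2 - r := by omega
        have := Q.col_strict' (j := j) h4 (mem_rectDiagram.2 ⟨h3, hj⟩)
        omega
  zeros' := by
    intro i j h
    have h' : ¬(i < 2 * r ∧ j < c) := fun hh => h (mem_rectDiagram.2 hh)
    rcases lt_or_ge i r with h1 | h1
    · rw [stackEntry_top _ _ h1]
      refine P.zeros' fun hh => h' ⟨by omega, (mem_rectDiagram.1 hh).2⟩
    · simp [stackEntry, not_lt.2 h1, h']
  bijOn' := by
    have hP := P.bijOn'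
    have hQ := Q.bijOn'
    rw [card_rectDiagram] at hP hQ ⊢
    have mem : ∀ {R i j : ℕ},
        (i, j) ∈ ((rectDiagram R c).cells : Set (ℕ × ℕ)) ↔ i < R ∧ j < c := by
      intro R i j
      rw [Finset.mem_coe, YoungDiagram.mem_cells, mem_rectDiagram]
    have e : 2 * r * c = r * c + r * c := by ring
    refine ⟨?_, ?_, ?_⟩
    · rintro ⟨i, j⟩ h
      obtain ⟨hi, hj⟩ := mem.1 h
      change stackEntry P Q i j ∈ Set.Icc 1 (2 * r * c)
      rw [Set.mem_Icc, e]
      rcases lt_or_ge i r with h1 | h1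
      · rw [stackEntry_top _ _ h1]
        have := P.entry_mem h1 hj
        omega
      · rw [stackEntry_bot _ _ h1 hi hj]
        have h2 : i - r < r := by omega
        have := Q.entry_mem h2 hj
        omega
    · rintro ⟨i, j⟩ h ⟨i', j'⟩ h' heq
      obtain ⟨hi, hj⟩ := mem.1 h
      obtain ⟨hi', hj'⟩ := mem.1 h'
      change stackEntry P Q i j = stackEntry P Q i' j' at heq
      rcases lt_or_ge i r with h1 | h1 <;> rcases lt_or_ge i' r with h2 | h2
      · rw [stackEntry_top _ _ h1, stackEntry_top _ _ h2] at heq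
        exact hP.injOn (mem.2 ⟨h1, hj⟩) (mem.2 ⟨h2, hj'⟩) heq
      · rw [stackEntry_top _ _ h1, stackEntry_bot _ _ h2 hi' hj'] at heq
        have h3 : i' - r < r := by omega
        have := P.entry_mem h1 hj
        have := Q.entry_mem h3 hj'
        omega
      · rw [stackEntry_top _ _ h2, stackEntry_bot _ _ h1 hi hj] at heq
        have h3 : i - r < r := by omega
        have := P.entry_mem h2 hj'
        have := Q.entry_mem h3 hj
        omega
      · rw [stackEntry_bot _ _ h1 hi hj, stackEntry_bot _ _ h2 hi' hj'] at heq
        have h3 : i - r < r := by omega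
        have h4 : i' - r < r := by omega
        have := hQ.injOn (mem.2 ⟨h3, hj⟩) (mem.2 ⟨h4, hj'⟩) (Nat.add_right_cancel heq)
        simp only [Prod.mk.injEq] at this ⊢
        omega
    · intro m hm
      rw [Set.mem_Icc, e] at hm
      rcases le_or_gt m (r * c) with hle | hgt
      · obtain ⟨⟨i, j⟩, h, hx⟩ := hP.surjOn (Set.mem_Icc.2 ⟨hm.1, hle⟩)
        obtain ⟨hi, hj⟩ := mem.1 h
        refine ⟨(i, j), mem.2 ⟨by omega, hj⟩, ?_⟩
        change stackEntry P Q i j = m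
        rw [stackEntry_top _ _ hi]
        exact hx
      · have hm' : m - r * c ∈ Set.Icc 1 (r * c) := by
          rw [Set.mem_Icc]
          omega
        obtain ⟨⟨i, j⟩, h, hx⟩ := hQ.surjOn hm'
        obtain ⟨hi, hj⟩ := mem.1 h
        have h1 : r ≤ i + r := by omega
        have h2 : i + r < 2 * r := by omega
        refine ⟨(i + r, j), mem.2 ⟨h2, hj⟩, ?_⟩
        change stackEntry P Q (i + r) j = m
        change Q.entry i j = m - r * c at hx
        rw [stackEntry_bot _ _ h1 h2 hj, Nat.add_sub_cancel, hx]
        omega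

/-- `SYT^stacked(2r × c)`: the tableaux of the form `stack(P, Q)` with `P, Q ∈ SYT(r × c)`. -/
def stackedSYT (r c : ℕ) : Set (RectSYT (2 * r) c) :=
  {S | ∃ P Q : RectSYT r c, S = stack P Q}

/-- One jeu de taquin slide of a filling `T` of `μ` with empty cell `p`: the smaller of the entries
right of and below the empty cell slides into it, and the value is the new position of the empty
cell. At an outer corner of `μ` the empty cell stays where it is. -/
def nextHole (μ : YoungDiagram) (T : ℕ → ℕ → ℕ) (p : ℕ × ℕ) : ℕ × ℕ :=
  if (p.1 + 1, p.2) ∈ μ ∧ ((p.1, p.2 + 1) ∈ μ → T (p.1 + 1) p.2 < T p.1 (p.2 + 1)) then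
    (p.1 + 1, p.2)
  else if (p.1, p.2 + 1) ∈ μ then (p.1, p.2 + 1)
  else p

/-- The position of the empty cell after `t` slides, when the entry of the northwest corner has
been deleted. Fewer than `|μ|` slides bring it to an outer corner. (A slide only changes the
cells that the empty cell has already left, so each slide compares entries of `T` itself.) -/
def hole (μ : YoungDiagram) (T : ℕ → ℕ → ℕ) (t : ℕ) : ℕ × ℕ :=
  (nextHole μ T)^[t] (0, 0)

/-- Gromotion of a filling `T` of `μ` with labels `a < a + 1 < … < a + |μ| - 1`: delete the
smallest label `a` (in the northwest corner), slide until the empty cell is at an outer corner, and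
fill that corner with the next label `a + |μ|`. -/
def gromotion (μ : YoungDiagram) (T : ℕ → ℕ → ℕ) (i j : ℕ) : ℕ :=
  if ∃ t < μ.card, hole μ T t = (i, j) then
    if nextHole μ T (i, j) = (i, j) then T 0 0 + μ.card
    else T (nextHole μ T (i, j)).1 (nextHole μ T (i, j)).2
  else T i j

/-- The set of entries that slide (upwards) into the `i`-th row, rows being counted from `1`, when
the gromotion of `T` is computed: the empty cell moves from the `i`-th row, which has index
`i - 1`, to the row with index `i`. For a rectangle with more than `i ≥ 1` rows, there is
exactly one. -/
def entriesSlidingInto (μ : YoungDiagram) (T : ℕ → ℕ → ℕ) (i : ℕ) : Finset ℕ :=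
  ((Finset.range μ.card).filter
    (fun t => (hole μ T t).1 + 1 = i ∧ (hole μ T (t + 1)).1 = i)).image
    (fun t => T (hole μ T (t + 1)).1 (hole μ T (t + 1)).2)

/-- The promotion permutation `prom_i(T)` in one-line notation, for `T ∈ SYT(R × C)` and
`1 ≤ i ≤ R - 1`. Its `k`-th value is the residue modulo `R * C` of the unique entry (the supremum
of a one-element set) that slides into row `i` when the `k`-th gromotion
`gromotion^k(T) = gromotion(gromotion^(k-1)(T))` is computed. The element `x` of `Fin (R * C)`
stands for `x + 1` in `{1, …, R * C}`. -/
def prom {R C : ℕ} (T : RectSYT R C) (i : ℕ) (k : Fin (R * C)) : Fin (R * C) :=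
  ⟨((entriesSlidingInto (rectDiagram R C) ((gromotion (rectDiagram R C))^[(k : ℕ)] T.entry) i).sup id
      - 1) % (R * C), Nat.mod_lt _ k.pos⟩

/-- `ρ` is an involution without fixed points, i.e. it encodes a perfect matching with blocks
`{a, ρ a}`. -/
def IsFixedPointFreeInvolution {N : ℕ} (ρ : Equiv.Perm (Fin N)) : Prop :=
  (∀ a, ρ (ρ a) = a) ∧ ∀ a, ρ a ≠ a

/-- The matching `ρ` has a `k`-crossing: blocks `{i₁ < j₁}, …, {i_k < j_k}` with
`i₁ < ⋯ < i_k < j₁ < ⋯ < j_k`. -/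
def HasCrossing {N : ℕ} (ρ : Equiv.Perm (Fin N)) (k : ℕ) : Prop :=
  ∃ i j : Fin k → Fin N, (∀ t, ρ (i t) = j t) ∧
    StrictMono i ∧ StrictMono j ∧ ∀ s t, i s < j t

/-- The matching `ρ` has a `k`-nesting: blocks `{i₁ < j₁}, …, {i_k < j_k}` with
`i₁ < ⋯ < i_k < j_k < ⋯ < j₁`. -/
def HasNesting {N : ℕ} (ρ : Equiv.Perm (Fin N)) (k : ℕ) : Prop :=
  ∃ i j : Fin k → Fin N, (∀ t, ρ (i t) = j t) ∧
    StrictMono i ∧ StrictAnti j ∧ ∀ s t, i s < j t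

/-- The maximum `k` for which there is a `k`-crossing (there is a `0`-crossing, and `k ≤ N` for
each `k`-crossing). -/
noncomputable def crossingNumber {N : ℕ} (ρ : Equiv.Perm (Fin N)) : ℕ :=
  sSup {k | HasCrossing ρ k}

/-- The maximum `k` for which there is a `k`-nesting. -/
noncomputable def nestingNumber {N : ℕ} (ρ : Equiv.Perm (Fin N)) : ℕ :=
  sSup {k | HasNesting ρ k}

/-!
Let `F` be the stacked tableau with upper half `P` and lower half `Q`, and `n = r * c`. The theorem
rests on an explicit formula for its promotion permutation: the involution `prom_r` exchanges the
entries `P(a, b)` and `n + Q(a, c - 1 - b)`, for all cells `(a, b)` of the `r × c` rectangle.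

The formula follows from the shapes of the windows of labels in the iterated gromotions of `F`. Read
the columns of the labels, in the order of the labels, as a word. A vertical slide does not change
this word, and a horizontal slide lowers one letter by one, at a place where the two letters involved
satisfy a ballot condition on either side. Such a step preserves, for each interval of labels and each
`m`, the largest size of a union of `m` weakly decreasing subsequences (Greene's invariants, see
`hasDecFamily_update_iff`; the proof exchanges tails of subsequences). These sizes are evident if the
window is left-justified, as it is once all smaller labels are gone, or right-justified, or consists
of a right-justified part above a left-justified one (`IsFilling.hasDecFamily_colOf_iff`), and they
then determine the columns of the window. Hence, after `k ≤ n` gromotions, the labels of `Q` form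
columns of full length that hang below the rotated complement of the shape of the `k` smallest labels
of `P` (`IsStackedFilling.iterate_apply`), and after `n` gromotions `P` and `Q` have exchanged their
places (`iterate_apply_top` and `iterate_apply_bot`). When the label `P(a, b)` is removed, the column
`c - 1 - b` of `Q` moves up by one row, so that `Q(a, c - 1 - b)` passes from the lower to the upper
half (`entriesSlidingInto_iterate`); the other gromotions are covered by exchanging `P` and `Q`.

By the formula, openers in the same column of `P` cross and openers in the same row nest. Thus the
crossing number is `r`, the nesting number is `c`, and the cell of an opener is given by the largest
sizes of a crossing and of a nesting that end at it (`matching_stacked`), which proves injectivity.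
Conversely, for a matching with these crossing and nesting numbers, the same two sizes distinguish
the `r * c` openers, as in the theorem of Erdős and Szekeres, and therefore arrange them and their
partners in two standard tableaux (`exists_stack_of_matching`).
-/

/-! ### Families of weakly decreasing subsequences -/

/-- The finite set `A` of positions of the word `y`, coloured by `f` with `m` colours, is a union of
`m` weakly decreasing subsequences: each colour class is one. -/
def IsDecFamily {α β : Type*} [LinearOrder α] [LinearOrder β] (y : α → β) (m : ℕ) (f : α → ℕ)
    (A : Finset α) : Prop :=
  (∀ a ∈ A, f a < m) ∧ ∀ a ∈ A, ∀ b ∈ A, a < b → f a = f b → y b ≤ y a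

/-- Lowering the letter at `p` from `hi` to the next smaller letter `lo` does not decrease the size
of the largest union of `m` weakly decreasing subsequences, if each segment of the word that begins
right after `p` has at least as many letters `lo` as letters `hi`. -/
theorem exists_isDecFamily_update {α β : Type*} [LinearOrder α] [LinearOrder β] {y : α → β}
    {lo hi : β} (hcov : lo ⋖ hi) {p : α} (hp : y p = hi) {W : Finset α}
    (hW : ∀ q, (W.filter fun x => p < x ∧ x ≤ q ∧ y x = hi).card ≤
      (W.filter fun x => p < x ∧ x ≤ q ∧ y x = lo).card)
    {m : ℕ} {f : α → ℕ} {A : Finset α} (hAW : A ⊆ W) (hA : IsDecFamily y m f A) :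
    ∃ A' ⊆ W, ∃ f', IsDecFamily (Function.update y p lo) m f' A' ∧ A.card ≤ A'.card := by
  classical
  obtain ⟨hm, hdec⟩ := hA
  have hlohi : lo < hi := hcov.lt
  have hup : ∀ {x}, lo < x → hi ≤ x := fun h => not_lt.1 fun h' => hcov.2 h h'
  by_cases hpA : p ∉ A
  · refine ⟨A, hAW, f, ⟨hm, fun a ha b hb hab hf => ?_⟩, le_rfl⟩
    rw [Function.update_of_ne (by rintro rfl; exact hpA hb),
      Function.update_of_ne (by rintro rfl; exact hpA ha)]
    exact hdec a ha b hb hab hf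
  rw [not_not] at hpA
  by_cases hgood : ∃ D < m, ∀ a ∈ A, f a = D → (a < p → lo ≤ y a) ∧ (p < a → y a ≤ lo)
  · -- Some colour can absorb the lowered letter.
    obtain ⟨D, hD, hDA⟩ := hgood
    refine ⟨A, hAW, Function.update f p D, ⟨fun a ha => ?_, fun a ha b hb hab hf => ?_⟩, le_rfl⟩
    · rcases eq_or_ne a p with rfl | h
      · simpa using hD
      · simpa [h] using hm a ha
    · rcases eq_or_ne a p with rfl | h
      · have h' : b ≠ a := hab.ne'
        simp only [Function.update_self, Function.update_of_ne h'] at hf ⊢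
        exact (hDA b hb hf.symm).2 hab
      · rcases eq_or_ne b p with rfl | h'
        · simp only [Function.update_self, Function.update_of_ne h] at hf ⊢
          exact (hDA a ha hf).1 hab
        · simp only [Function.update_of_ne h, Function.update_of_ne h'] at hf ⊢
          exact hdec a ha b hb hab hf
  push Not at hgood
  -- Otherwise the colours whose letters behind `p` include a letter above `lo` have a last such
  -- position; `v` is the smallest of these, and the tails behind `v` are exchanged.
  have hlast : ∀ a ∈ A, p < a → lo < y a → ∃ v ∈ A.filter (fun x => p < x ∧ lo < y x ∧
      ∀ x' ∈ A, x < x' → f x' = f x → y x' ≤ lo), f v = f a ∧ a ≤ v := by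
    intro a ha hpa hla
    have hne : (A.filter fun x => f x = f a ∧ p < x ∧ lo < y x).Nonempty :=
      ⟨a, by simp [ha, hpa, hla]⟩
    obtain ⟨v, hv, hmax⟩ := Finset.exists_max_image _ id hne
    rw [Finset.mem_filter] at hv
    refine ⟨v, ?_, hv.2.1, hmax a (by simp [ha, hpa, hla])⟩
    rw [Finset.mem_filter]
    refine ⟨hv.1, hv.2.2.1, hv.2.2.2, fun x' hx' hlt hf => ?_⟩
    by_contra hcon
    have := hmax x' (by
      rw [Finset.mem_filter]
      exact ⟨hx', hf.trans hv.2.1, hv.2.2.1.trans hlt, not_le.1 hcon⟩)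
    exact absurd hlt (not_lt.2 this)
  set V := A.filter (fun x => p < x ∧ lo < y x ∧
      ∀ x' ∈ A, x < x' → f x' = f x → y x' ≤ lo) with hV
  obtain ⟨v₀, hv₀, hv₀f⟩ : ∃ v ∈ V, f v = f p := by
    obtain ⟨a, ha, hfa, h⟩ := hgood (f p) (hm p hpA)
    obtain ⟨h1, h2⟩ : p < a ∧ lo < y a := by
      by_cases h1 : a < p ∧ y a < lo
      · have := hdec a ha p hpA h1.1 hfa
        exact absurd (this.trans_lt h1.2) (by rw [hp]; exact hlohi.not_gt)
      · rw [not_and] at h1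
        exact h fun h' => not_lt.1 (h1 h')
    obtain ⟨v, hv, hvf, -⟩ := hlast a ha h1 h2
    exact ⟨v, hv, hvf.trans hfa⟩
  obtain ⟨v, hv, hmin⟩ := Finset.exists_min_image V id ⟨v₀, hv₀⟩
  simp only [id] at hmin
  obtain ⟨hvA, hpv, hlv, hvlast⟩ := Finset.mem_filter.1 hv
  -- Behind `p` and up to `v`, no letter `lo` is used, and the colour of `p` uses only `hi`.
  have hnolo : ∀ x ∈ A, p < x → x ≤ v → y x ≠ lo := by
    intro x hx hpx hxv hyx
    obtain ⟨a, ha, hfa, h⟩ := hgood (f x) (hm x hx)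
    obtain ⟨h1, h2⟩ : p < a ∧ lo < y a := by
      by_cases h1 : a < p ∧ y a < lo
      · have := hdec a ha x hx (h1.1.trans hpx) hfa
        exact absurd (this.trans_lt h1.2) (by rw [hyx]; exact lt_irrefl _)
      · rw [not_and] at h1
        exact h fun h' => not_lt.1 (h1 h')
    obtain ⟨v', hv', hvf, -⟩ := hlast a ha h1 h2
    have hle := hmin v' hv'
    obtain ⟨hvA', -, hlv', -⟩ := Finset.mem_filter.1 hv'
    rcases (hxv.trans hle).eq_or_lt with rfl | hlt
    · exact hlv'.ne' hyx
    · have := hdec x hx v' hvA' hlt (hvf.trans hfa).symm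
      rw [hyx] at this
      exact absurd hlv' (not_lt.2 this)
  have hhi : ∀ x ∈ A, p < x → x ≤ v → f x = f p → y x = hi := by
    intro x hx hpx hxv hfx
    refine le_antisymm (hp ▸ hdec p hpA x hx hpx hfx.symm) (hup ?_)
    obtain ⟨hvA', -, hlv', -⟩ := Finset.mem_filter.1 hv₀
    rcases (hxv.trans (hmin v₀ hv₀)).eq_or_lt with rfl | hlt
    · exact hlv'
    · exact hlv'.trans_le (hdec x hx v₀ hvA' hlt (hfx.trans hv₀f.symm))
  set Rm := A.filter (fun x => p < x ∧ x ≤ v ∧ f x = f p) with hRm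
  set Ad := W.filter (fun x => p < x ∧ x ≤ v ∧ y x = lo) with hAd
  refine ⟨(A \ Rm) ∪ Ad, ?_, fun x => if x ≤ v then (if p < x ∧ y x = lo then f p else f x)
    else Equiv.swap (f p) (f v) (f x), ⟨?_, ?_⟩, ?_⟩
  · exact Finset.union_subset (Finset.sdiff_subset.trans hAW) (Finset.filter_subset _ _)
  · intro a ha
    dsimp only
    have key : a ≤ v ∧ p < a ∧ y a = lo ∨ a ∈ A := by
      rw [Finset.mem_union] at ha
      rcases ha with ha | ha
      · exact Or.inr (Finset.mem_sdiff.1 ha).1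
      · rw [hAd, Finset.mem_filter] at ha
        exact Or.inl ⟨ha.2.2.1, ha.2.1, ha.2.2.2⟩
    rcases key with h | h
    · rw [if_pos h.1, if_pos h.2]
      exact hm p hpA
    · split_ifs
      · exact hm p hpA
      · exact hm a h
      · rw [Equiv.swap_apply_def]
        split_ifs
        · exact hm v hvA
        · exact hm p hpA
        · exact hm a h
  · -- Either `a` is a new letter `lo`, or an old position that is kept.
    have key : ∀ a ∈ (A \ Rm) ∪ Ad, (p < a ∧ a ≤ v ∧ y a = lo) ∨
        (a ∈ A ∧ ¬(p < a ∧ a ≤ v ∧ f a = f p) ∧ ¬(a ≤ v ∧ p < a ∧ y a = lo)) := by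
      intro a ha
      rw [Finset.mem_union] at ha
      rcases ha with ha | ha
      · obtain ⟨h1, h2⟩ := Finset.mem_sdiff.1 ha
        refine Or.inr ⟨h1, fun h => h2 (Finset.mem_filter.2 ⟨h1, h⟩), fun h => ?_⟩
        exact hnolo a h1 h.2.1 h.1 h.2.2
      · rw [hAd, Finset.mem_filter] at ha
        exact Or.inl ha.2
    intro a ha b hb hab hf
    dsimp only at hf
    have hya : Function.update y p lo a = y a ∨ a = p ∧ Function.update y p lo a = lo := by
      rcases eq_or_ne a p with rfl | h
      · simp
      · simp [h]
    have hyb : Function.update y p lo b ≤ y b := by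
      rcases eq_or_ne b p with rfl | h
      · simpa [hp] using hlohi.le
      · simp [h]
    have hblast : ∀ x ∈ A, v < x → f x = f p → y x ≤ hi := fun x hx hvx hfx =>
      hp ▸ hdec p hpA x hx (hpv.trans hvx) hfx.symm
    rcases key a ha with ⟨hpa, hav, hya'⟩ | ⟨haA, haR, haL⟩
    · rw [if_pos hav, if_pos ⟨hpa, hya'⟩] at hf
      rw [Function.update_of_ne hpa.ne', hya']
      refine hyb.trans ?_
      rcases key b hb with ⟨hpb, hbv, hyb'⟩ | ⟨hbA, hbR, hbL⟩
      · exact hyb'.le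
      · by_cases hbv : b ≤ v
        · rw [if_pos hbv, if_neg fun h => hbL ⟨hbv, h⟩] at hf
          exact absurd ⟨hpa.trans hab, hbv, hf.symm⟩ hbR
        · rw [if_neg hbv] at hf
          have : f b = f v := by
            rw [eq_comm, Equiv.swap_apply_eq_iff, Equiv.swap_apply_left] at hf
            exact hf
          exact hvlast b hbA (not_le.1 hbv) this
    · by_cases hav : a ≤ v
      · rw [if_pos hav, if_neg fun h => haL ⟨hav, h⟩] at hf
        rcases key b hb with ⟨hpb, hbv, hyb'⟩ | ⟨hbA, hbR, hbL⟩
        · rw [if_pos hbv, if_pos ⟨hpb, hyb'⟩] at hf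
          have hap : a ≤ p := not_lt.1 fun h => haR ⟨h, hav, hf⟩
          rcases hya with h | h
          · rw [h]
            refine hyb.trans (hyb'.le.trans ?_)
            rcases hap.eq_or_lt with rfl | h'
            · exact hp ▸ hlohi.le
            · exact hlohi.le.trans (hp ▸ hdec a haA p hpA h' hf)
          · rw [h.2]
            exact hyb.trans hyb'.le
        · by_cases hbv : b ≤ v
          · rw [if_pos hbv, if_neg fun h => hbL ⟨hbv, h⟩] at hf
            have h1 := hdec a haA b hbA hab hf
            rcases hya with h | ⟨rfl, h⟩
            · rw [h]
              exact hyb.trans h1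
            · exact absurd ⟨hab, hbv, hf.symm⟩ hbR
          · rw [if_neg hbv] at hf
            have hvb := not_le.1 hbv
            have hbp : b ≠ p := (hpv.trans hvb).ne'
            rw [eq_comm, Equiv.swap_apply_eq_iff, Equiv.swap_apply_def] at hf
            split_ifs at hf with h1 h2
            · -- The colour of `p` continues with the tail of the colour of `v`.
              have hb1 : y b ≤ lo := hvlast b hbA hvb hf
              have hap : a ≤ p := not_lt.1 fun h => haR ⟨h, hav, h1⟩
              refine hyb.trans (hb1.trans ?_)
              rcases hya with h | h
              · rw [h]
                rcases hap.eq_or_lt with rfl | h'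
                · exact hp ▸ hlohi.le
                · exact hlohi.le.trans (hp ▸ hdec a haA p hpA h' h1)
              · exact h.2.ge
            · -- The colour of `v` continues with the tail of the colour of `p`.
              have hb1 : y b ≤ hi := hblast b hbA hvb hf
              have ha1 : hi ≤ y a := by
                rcases hav.eq_or_lt with rfl | h'
                · exact hup hlv
                · exact hup (hlv.trans_le (hdec a haA v hvA h' h2))
              rcases hya with h | h
              · rw [h]
                exact hyb.trans (hb1.trans ha1)
              · exact absurd (congrArg f h.1) h1
            · have h3 := hdec a haA b hbA hab hf.symm
              rcases hya with h | h
              · rw [h]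
                exact hyb.trans h3
              · exact absurd (congrArg f h.1) h1
      · have hva := not_le.1 hav
        have hbv : ¬ b ≤ v := not_le.2 (hva.trans hab)
        rw [if_neg hav, if_neg hbv] at hf
        have hf' := (Equiv.swap (f p) (f v)).injective hf
        rcases key b hb with ⟨hpb, hbv', -⟩ | ⟨hbA, -, -⟩
        · exact absurd hbv' hbv
        · rw [Function.update_of_ne (hpv.trans hva).ne']
          exact hyb.trans (hdec a haA b hbA hab hf')
  · have hdisj : Disjoint (A \ Rm) Ad := by
      rw [Finset.disjoint_left]
      intro x hx hx'
      rw [hAd, Finset.mem_filter] at hx'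
      exact hnolo x (Finset.mem_sdiff.1 hx).1 hx'.2.1 hx'.2.2.1 hx'.2.2.2
    have hsub : Rm ⊆ W.filter (fun x => p < x ∧ x ≤ v ∧ y x = hi) := by
      intro x hx
      rw [hRm, Finset.mem_filter] at hx
      rw [Finset.mem_filter]
      exact ⟨hAW hx.1, hx.2.1, hx.2.2.1, hhi x hx.1 hx.2.1 hx.2.2.1 hx.2.2.2⟩
    have h1 : Rm.card ≤ Ad.card := (Finset.card_le_card hsub).trans (hW v)
    have h2 : (A \ Rm).card + Rm.card = A.card :=
      Finset.card_sdiff_add_card_eq_card (Finset.filter_subset _ _)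
    rw [Finset.card_union_of_disjoint hdisj]
    omega

/-- The window `W` of the word `y` contains a union of `m` weakly decreasing subsequences with at
least `v` letters. The largest such `v` is Greene's invariant of the window. -/
def HasDecFamily {α β : Type*} [LinearOrder α] [LinearOrder β] (y : α → β) (W : Finset α)
    (m v : ℕ) : Prop :=
  ∃ A ⊆ W, ∃ f, IsDecFamily y m f A ∧ v ≤ A.card

theorem HasDecFamily.congr {α β : Type*} [LinearOrder α] [LinearOrder β] {y y' : α → β}
    {W : Finset α} {m v : ℕ} (h : HasDecFamily y W m v) (hy : ∀ x ∈ W, y x = y' x) :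
    HasDecFamily y' W m v := by
  obtain ⟨A, hA, f, hf, hv⟩ := h
  refine ⟨A, hA, f, ⟨hf.1, fun a ha b hb hab hfab => ?_⟩, hv⟩
  rw [← hy a (hA ha), ← hy b (hA hb)]
  exact hf.2 a ha b hb hab hfab

/-- Lowering the letter at `p` from `hi` to the next smaller letter `lo` preserves Greene's
invariants of the window `W` if, in `W`, the letters `lo` and `hi` behind `p` satisfy the ballot
condition, and so do, from right to left, the letters `hi` and `lo` before `p`. The two directions
are exchanged by reversing both the positions and the alphabet. -/
theorem hasDecFamily_update_iff {α β : Type*} [LinearOrder α] [LinearOrder β] {y : α → β}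
    {lo hi : β} (hcov : lo ⋖ hi) {p : α} (hp : y p = hi) {W : Finset α}
    (hW : ∀ q, (W.filter fun x => p < x ∧ x ≤ q ∧ y x = hi).card ≤
      (W.filter fun x => p < x ∧ x ≤ q ∧ y x = lo).card)
    (hW' : ∀ q, (W.filter fun x => x < p ∧ q ≤ x ∧ y x = lo).card ≤
      (W.filter fun x => x < p ∧ q ≤ x ∧ y x = hi).card) {m v : ℕ} :
    HasDecFamily (Function.update y p lo) W m v ↔ HasDecFamily y W m v := by
  constructor
  · rintro ⟨A, hA, f, hf, hv⟩
    have hne : ∀ x, x < p → Function.update y p lo x = y x :=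
      fun x hx => Function.update_of_ne hx.ne _ _
    have hq : ∀ q, (W.filter fun x => x < p ∧ q ≤ x ∧ Function.update y p lo x = lo).card ≤
        (W.filter fun x => x < p ∧ q ≤ x ∧ Function.update y p lo x = hi).card := by
      intro q
      have h : ∀ l, (W.filter fun x => x < p ∧ q ≤ x ∧ Function.update y p lo x = l) =
          W.filter fun x => x < p ∧ q ≤ x ∧ y x = l := fun l =>
        Finset.filter_congr fun x _ => and_congr_right fun hx => by rw [hne x hx]
      rw [h, h]
      exact hW' q
    obtain ⟨A', hA', f', hf', hv'⟩ := exists_isDecFamily_update (α := αᵒᵈ) (β := βᵒᵈ)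
      (y := Function.update y p lo) (lo := hi) (hi := lo) (p := p) (W := W) (m := m) (f := f)
      (A := A) hcov.toDual (Function.update_self ..) (fun q => hq q) hA
      ⟨hf.1, fun a ha b hb hab hfab => hf.2 b hb a ha hab hfab.symm⟩
    refine ⟨A', hA', f', ⟨hf'.1, fun a ha b hb hab hfab => ?_⟩, hv.trans hv'⟩
    have h : Function.update (Function.update y p lo) p hi = y := by
      rw [Function.update_idem, ← hp, Function.update_eq_self]
    have h2 := hf'.2 b hb a ha hab hfab.symm
    have h3 : Function.update (Function.update y p lo) p hi b ≤
      Function.update (Function.update y p lo) p hi a := h2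
    rwa [h] at h3
  · rintro ⟨A, hA, f, hf, hv⟩
    obtain ⟨A', hA', f', hf', hv'⟩ := exists_isDecFamily_update hcov hp hW hA hf
    exact ⟨A', hA', f', hf', hv.trans hv'⟩

/-! ### Jeu de taquin on a rectangle -/

/-- `T` fills the `R × C` rectangle with the labels `s + 1, …, s + R * C`, strictly increasing along
rows and down columns; values of `T` outside of the rectangle are irrelevant. -/
structure IsFilling (R C s : ℕ) (T : ℕ → ℕ → ℕ) : Prop where
  lt : ∀ p q : ℕ × ℕ, p ≤ q → p ≠ q → q ∈ rectDiagram R C → T p.1 p.2 < T q.1 q.2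
  bij : Set.BijOn (fun p : ℕ × ℕ => T p.1 p.2) {p | p ∈ rectDiagram R C} (Set.Ioc s (s + R * C))

/-- `F` fills the `R × C` rectangle without the empty cell `h` with the labels
`s + 2, …, s + R * C`, increasingly for the componentwise order of the cells. -/
structure IsPuncturedFilling (R C s : ℕ) (h : ℕ × ℕ) (F : ℕ × ℕ → ℕ) : Prop where
  mem : h ∈ rectDiagram R C
  lt : ∀ p q : ℕ × ℕ, p ≤ q → p ≠ q → p ≠ h → q ≠ h → q ∈ rectDiagram R C → F p < F q
  bij : Set.BijOn F {p | p ∈ rectDiagram R C ∧ p ≠ h} (Set.Ioc (s + 1) (s + R * C))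

theorem mem_rectDiagram_of_le {R C : ℕ} {p q : ℕ × ℕ} (hpq : p ≤ q) (hq : q ∈ rectDiagram R C) :
    p ∈ rectDiagram R C := by
  rw [mem_rectDiagram] at *
  exact ⟨hpq.1.trans_lt hq.1, hpq.2.trans_lt hq.2⟩

theorem nextHole_cases {R C : ℕ} (T : ℕ → ℕ → ℕ) {p : ℕ × ℕ} (hp : p ∈ rectDiagram R C) :
    (nextHole (rectDiagram R C) T p = (p.1 + 1, p.2) ∧ (p.1 + 1, p.2) ∈ rectDiagram R C ∧
      ((p.1, p.2 + 1) ∈ rectDiagram R C → T (p.1 + 1) p.2 < T p.1 (p.2 + 1))) ∨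
    (nextHole (rectDiagram R C) T p = (p.1, p.2 + 1) ∧ (p.1, p.2 + 1) ∈ rectDiagram R C ∧
      ((p.1 + 1, p.2) ∈ rectDiagram R C → T p.1 (p.2 + 1) ≤ T (p.1 + 1) p.2)) ∨
    (nextHole (rectDiagram R C) T p = p ∧ p.1 + 1 = R ∧ p.2 + 1 = C) := by
  unfold nextHole
  split_ifs with h1 h2
  · exact Or.inl ⟨rfl, h1⟩
  · refine Or.inr (Or.inl ⟨rfl, h2, fun h3 => ?_⟩)
    by_contra h4
    exact h1 ⟨h3, fun _ => not_le.1 h4⟩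
  · refine Or.inr (Or.inr ⟨rfl, ?_⟩)
    rw [mem_rectDiagram] at hp h2
    have h3 : (p.1 + 1, p.2) ∉ rectDiagram R C := fun h => h1 ⟨h, fun h' =>
      absurd (mem_rectDiagram.1 h') h2⟩
    rw [mem_rectDiagram] at h3
    simp only [not_and_or, not_lt] at h2 h3
    omega

section Path

variable {R C : ℕ} {T : ℕ → ℕ → ℕ}

theorem hole_succ (μ : YoungDiagram) (T : ℕ → ℕ → ℕ) (t : ℕ) :
    hole μ T (t + 1) = nextHole μ T (hole μ T t) :=
  Function.iterate_succ_apply' _ _ _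

theorem hole_mem (h0 : (0, 0) ∈ rectDiagram R C) (t : ℕ) :
    hole (rectDiagram R C) T t ∈ rectDiagram R C := by
  induction t with
  | zero => exact h0
  | succ t ih =>
    rw [hole_succ]
    rcases nextHole_cases T ih with h | h | h
    · rw [h.1]; exact h.2.1
    · rw [h.1]; exact h.2.1
    · rw [h.1]; exact ih

theorem hole_mono (h0 : (0, 0) ∈ rectDiagram R C) : Monotone (hole (rectDiagram R C) T) := by
  refine monotone_nat_of_le_succ fun t => ?_
  rw [hole_succ]
  rcases nextHole_cases T (hole_mem h0 t) with h | h | h <;> rw [h.1]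
  · exact ⟨Nat.le_succ _, le_rfl⟩
  · exact ⟨le_rfl, Nat.le_succ _⟩

/-- The empty cell reaches the southeast corner in `R + C - 2` slides. -/
theorem hole_add (h0 : (0, 0) ∈ rectDiagram R C) (t : ℕ) :
    (hole (rectDiagram R C) T t).1 + (hole (rectDiagram R C) T t).2 = min t (R + C - 2) := by
  induction t with
  | zero => simp [hole]
  | succ t ih =>
    have hm := mem_rectDiagram.1 (hole_mem (T := T) h0 t)
    rw [hole_succ]
    rcases nextHole_cases T (hole_mem h0 t) with h | h | h <;> rw [h.1]
    · have := mem_rectDiagram.1 h.2.1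
      dsimp only at this ⊢
      omega
    · have := mem_rectDiagram.1 h.2.1
      dsimp only at this ⊢
      omega
    · omega

theorem hole_eq_corner (h0 : (0, 0) ∈ rectDiagram R C) {t : ℕ} (ht : R + C - 2 ≤ t) :
    hole (rectDiagram R C) T t = (R - 1, C - 1) := by
  have h1 := hole_add (T := T) h0 t
  have h2 := mem_rectDiagram.1 (hole_mem (T := T) h0 t)
  rw [min_eq_right ht] at h1
  ext <;> dsimp only <;> omega

/-- The filling after `t` slides. Its value at the empty cell `hole μ T t` is irrelevant. -/
def slid (μ : YoungDiagram) (T : ℕ → ℕ → ℕ) (t : ℕ) (p : ℕ × ℕ) : ℕ :=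
  open Classical in
  if ∃ t' < t, hole μ T t' = p then T (nextHole μ T p).1 (nextHole μ T p).2 else T p.1 p.2

theorem slid_zero (μ : YoungDiagram) (T : ℕ → ℕ → ℕ) (p : ℕ × ℕ) :
    slid μ T 0 p = T p.1 p.2 := by
  simp [slid]

theorem slid_succ (μ : YoungDiagram) (T : ℕ → ℕ → ℕ) (t : ℕ) :
    slid μ T (t + 1) = Function.update (slid μ T t) (hole μ T t)
      (T (hole μ T (t + 1)).1 (hole μ T (t + 1)).2) := by
  funext p
  rcases eq_or_ne p (hole μ T t) with rfl | hp
  · rw [Function.update_self, hole_succ, slid, if_pos ⟨t, Nat.lt_succ_self t, rfl⟩]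
  · rw [Function.update_of_ne hp]
    unfold slid
    congr 1
    refine propext ⟨fun ⟨t', ht', h⟩ => ⟨t', ?_, h⟩,
      fun ⟨t', ht', h⟩ => ⟨t', ht'.trans t.lt_succ_self, h⟩⟩
    refine (Nat.lt_succ_iff_lt_or_eq.1 ht').resolve_right ?_
    rintro rfl
    exact hp h.symm

theorem slid_of_not_le (h0 : (0, 0) ∈ rectDiagram R C) {t : ℕ} {p : ℕ × ℕ}
    (hp : ¬p ≤ hole (rectDiagram R C) T t) : slid (rectDiagram R C) T t p = T p.1 p.2 := by
  rw [slid, if_neg]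
  rintro ⟨t', ht', rfl⟩
  exact hp (hole_mono h0 ht'.le)

theorem IsFilling.apply_zero {s : ℕ} (hT : IsFilling R C s T) (h0 : (0, 0) ∈ rectDiagram R C) :
    T 0 0 = s + 1 := by
  have hm := mem_rectDiagram.1 h0
  have hpos : 0 < R * C := Nat.mul_pos hm.1 hm.2
  obtain ⟨q, hq, hqs⟩ := hT.bij.surjOn (show s + 1 ∈ Set.Ioc s (s + R * C) from
    ⟨Nat.lt_succ_self s, by omega⟩)
  dsimp only at hqs
  have h1 := (hT.bij.mapsTo (show (0, 0) ∈ {p | p ∈ rectDiagram R C} from h0)).1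
  dsimp only at h1
  by_cases hq0 : (0, 0) = q
  · subst hq0
    exact hqs
  · have := hT.lt (0, 0) q ⟨Nat.zero_le _, Nat.zero_le _⟩ hq0 hq
    dsimp only at this
    omega

theorem IsFilling.isPuncturedFilling {s : ℕ} (hT : IsFilling R C s T)
    (h0 : (0, 0) ∈ rectDiagram R C) :
    IsPuncturedFilling R C s (0, 0) fun p => T p.1 p.2 := by
  have h00 := hT.apply_zero h0
  refine ⟨h0, fun p q hpq hne _ _ hq => hT.lt p q hpq hne hq, fun p hp => ?_,
    hT.bij.injOn.mono fun p hp => hp.1, fun x hx => ?_⟩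
  · have h1 := hT.bij.mapsTo hp.1
    have h2 := hT.lt (0, 0) p ⟨Nat.zero_le _, Nat.zero_le _⟩ hp.2.symm hp.1
    dsimp only at h1 h2
    exact ⟨show s + 1 < T p.1 p.2 by omega, h1.2⟩
  · obtain ⟨q, hq, hqx⟩ := hT.bij.surjOn (show x ∈ Set.Ioc s (s + R * C) from
      ⟨(Nat.lt_succ_self s).trans hx.1, hx.2⟩)
    refine ⟨q, ⟨hq, ?_⟩, hqx⟩
    rintro rfl
    have := hx.1
    dsimp only at hqx
    omega

/-- A slide of the entry at `h'` into the empty cell `h`, for adjacent cells, keeps a punctured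
filling increasing if the entry at `h'` is the smaller one of the entries right of and below `h`. -/
theorem IsPuncturedFilling.update {s : ℕ} {h h' : ℕ × ℕ} {F : ℕ × ℕ → ℕ}
    (hF : IsPuncturedFilling R C s h F) (hne : h ≠ h') (hh' : h' ∈ rectDiagram R C) (hle : h ≤ h')
    (hmin : ∀ q, h ≤ q → h ≠ q → q ≠ h' → q ∈ rectDiagram R C → F h' < F q) :
    IsPuncturedFilling R C s h' (Function.update F h (F h')) := by
  refine ⟨hh', fun p q hpq hpq' hp hq hqm => ?_, ?_, ?_, ?_⟩
  · rcases eq_or_ne p h with rfl | hph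
    · rw [Function.update_self, Function.update_of_ne hpq'.symm]
      exact hmin q hpq hpq' hq hqm
    · rw [Function.update_of_ne hph]
      rcases eq_or_ne q h with rfl | hqh
      · rw [Function.update_self]
        exact hF.lt p h' (hpq.trans hle) hp hph hne.symm hh'
      · rw [Function.update_of_ne hqh]
        exact hF.lt p q hpq hpq' hph hqh hqm
  · rintro p ⟨hpm, hp⟩
    rcases eq_or_ne p h with rfl | hph
    · rw [Function.update_self]
      exact hF.bij.mapsTo ⟨hh', hne.symm⟩
    · rw [Function.update_of_ne hph]
      exact hF.bij.mapsTo ⟨hpm, hph⟩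
  · rintro p ⟨hpm, hp⟩ q ⟨hqm, hq⟩ hpq
    rcases eq_or_ne p h with hph | hph <;> rcases eq_or_ne q h with hqh | hqh
    · exact hph.trans hqh.symm
    · rw [hph, Function.update_self, Function.update_of_ne hqh] at hpq
      exact absurd (hF.bij.injOn ⟨hh', hne.symm⟩ ⟨hqm, hqh⟩ hpq).symm hq
    · rw [hqh, Function.update_self, Function.update_of_ne hph] at hpq
      exact absurd (hF.bij.injOn ⟨hpm, hph⟩ ⟨hh', hne.symm⟩ hpq) hp
    · rw [Function.update_of_ne hph, Function.update_of_ne hqh] at hpq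
      exact hF.bij.injOn ⟨hpm, hph⟩ ⟨hqm, hqh⟩ hpq
  · intro x hx
    obtain ⟨q, ⟨hqm, hqh⟩, hqx⟩ := hF.bij.surjOn hx
    rcases eq_or_ne q h' with rfl | hq
    · exact ⟨h, ⟨hF.mem, hne⟩, by rw [Function.update_self, hqx]⟩
    · exact ⟨q, ⟨hqm, hq⟩, by rw [Function.update_of_ne hqh, hqx]⟩

theorem IsPuncturedFilling.congr {s : ℕ} {h : ℕ × ℕ} {F F' : ℕ × ℕ → ℕ}
    (hF : IsPuncturedFilling R C s h F) (hFF' : ∀ p, p ≠ h → F p = F' p) :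
    IsPuncturedFilling R C s h F' := by
  refine ⟨hF.mem, fun p q hpq hpq' hp hq hqm => ?_, hF.bij.congr fun p hp => hFF' p hp.2⟩
  rw [← hFF' p hp, ← hFF' q hq]
  exact hF.lt p q hpq hpq' hp hq hqm

end Path

section Path

variable {R C : ℕ} {T : ℕ → ℕ → ℕ}

theorem isPuncturedFilling_slid {s : ℕ} (hT : IsFilling R C s T) (h0 : (0, 0) ∈ rectDiagram R C)
    (t : ℕ) :
    IsPuncturedFilling R C s (hole (rectDiagram R C) T t) (slid (rectDiagram R C) T t) := by
  induction t with
  | zero => exact (hT.isPuncturedFilling h0).congr fun p _ => (slid_zero _ _ p).symm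
  | succ t ih =>
    have hs := slid_succ (rectDiagram R C) T t
    rw [hole_succ] at hs ⊢
    set h := hole (rectDiagram R C) T t with hh
    have hbelow : slid (rectDiagram R C) T t (h.1 + 1, h.2) = T (h.1 + 1) h.2 :=
      slid_of_not_le h0 fun h' => absurd h'.1 (Nat.not_succ_le_self _)
    have hright : slid (rectDiagram R C) T t (h.1, h.2 + 1) = T h.1 (h.2 + 1) :=
      slid_of_not_le h0 fun h' => absurd h'.2 (Nat.not_succ_le_self _)
    have hnb : (h.1 + 1, h.2) ≠ h := fun e => Nat.succ_ne_self _ (congrArg Prod.fst e)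
    have hnr : (h.1, h.2 + 1) ≠ h := fun e => Nat.succ_ne_self _ (congrArg Prod.snd e)
    rcases nextHole_cases T ih.mem with ⟨h1, h2, h3⟩ | ⟨h1, h2, h3⟩ | ⟨h1, h2, h3⟩ <;>
      rw [h1] at hs ⊢
    · rw [hs]
      dsimp only
      rw [← hbelow]
      refine ih.update hnb.symm h2 ⟨Nat.le_succ _, le_rfl⟩ fun q hhq hq1 hq2 hqm => ?_
      rcases Nat.lt_or_ge h.1 q.1 with hlt | hge
      · exact ih.lt _ _ ⟨hlt, hhq.2⟩ hq2.symm hnb hq1.symm hqm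
      · have h4 : h.2 + 1 ≤ q.2 := by
          rcases Nat.lt_or_ge h.2 q.2 with h5 | h5
          · exact h5
          · exact absurd (Prod.ext (le_antisymm hhq.1 hge) (le_antisymm hhq.2 h5)) hq1
        have h5 : ((h.1, h.2 + 1) : ℕ × ℕ) ≤ q := ⟨hhq.1, h4⟩
        have h6 := h3 (mem_rectDiagram_of_le h5 hqm)
        rw [← hbelow, ← hright] at h6
        rcases eq_or_ne (h.1, h.2 + 1) q with h7 | h7
        · rwa [← h7]
        · exact h6.trans (ih.lt _ _ h5 h7 hnr hq1.symm hqm)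
    · rw [hs]
      dsimp only
      rw [← hright]
      refine ih.update hnr.symm h2 ⟨le_rfl, Nat.le_succ _⟩ fun q hhq hq1 hq2 hqm => ?_
      rcases Nat.lt_or_ge h.2 q.2 with hlt | hge
      · exact ih.lt _ _ ⟨hhq.1, hlt⟩ hq2.symm hnr hq1.symm hqm
      · have h4 : h.1 + 1 ≤ q.1 := by
          rcases Nat.lt_or_ge h.1 q.1 with h5 | h5
          · exact h5
          · exact absurd (Prod.ext (le_antisymm hhq.1 h5) (le_antisymm hhq.2 hge)) hq1
        have h5 : ((h.1 + 1, h.2) : ℕ × ℕ) ≤ q := ⟨h4, hhq.2⟩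
        have hbm := mem_rectDiagram_of_le h5 hqm
        have h6 := h3 hbm
        rw [← hbelow, ← hright] at h6
        have h7 : slid (rectDiagram R C) T t (h.1, h.2 + 1) ≠
            slid (rectDiagram R C) T t (h.1 + 1, h.2) := fun e =>
          Nat.succ_ne_self _ (congrArg Prod.snd (ih.bij.injOn ⟨h2, hnr⟩ ⟨hbm, hnb⟩ e))
        rcases eq_or_ne (h.1 + 1, h.2) q with h8 | h8
        · rw [← h8]
          exact lt_of_le_of_ne h6 h7
        · exact (lt_of_le_of_ne h6 h7).trans (ih.lt _ _ h5 h8 hnb hq1.symm hqm)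
    · rw [hs]
      exact ih.congr fun p hp => (Function.update_of_ne hp _ _).symm

/-- A horizontal slide lowers one letter of the word that lists the columns of the labels. It
preserves Greene's invariants of each window of labels: the cells of the two columns involved
pair up along the rows, which gives the ballot conditions. -/
theorem IsPuncturedFilling.hasDecFamily_update_iff {s : ℕ} {h : ℕ × ℕ} {F : ℕ × ℕ → ℕ}
    (hF : IsPuncturedFilling R C s h F) (hr : (h.1, h.2 + 1) ∈ rectDiagram R C)
    (hb : (h.1 + 1, h.2) ∈ rectDiagram R C → F (h.1, h.2 + 1) < F (h.1 + 1, h.2)) {y : ℕ → ℕ}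
    (hy : ∀ q ∈ rectDiagram R C, q ≠ h → y (F q) = q.2) {lo hi : ℕ} (hlo : s + 1 ≤ lo)
    (hhi : hi ≤ s + R * C) {m v : ℕ} :
    HasDecFamily (Function.update y (F (h.1, h.2 + 1)) h.2) (Finset.Ioc lo hi) m v ↔
      HasDecFamily y (Finset.Ioc lo hi) m v := by
  have hnr : (h.1, h.2 + 1) ≠ h := fun e => Nat.succ_ne_self _ (congrArg Prod.snd e)
  set p := F (h.1, h.2 + 1) with hp
  have hcell : ∀ x ∈ Finset.Ioc lo hi, ∃ q, q ∈ rectDiagram R C ∧ q ≠ h ∧ F q = x := by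
    intro x hx
    rw [Finset.mem_Ioc] at hx
    obtain ⟨q, hq, hqx⟩ := hF.bij.surjOn (show x ∈ Set.Ioc (s + 1) (s + R * C) from
      ⟨by omega, by omega⟩)
    exact ⟨q, hq.1, hq.2, hqx⟩
  by_cases hpW : p ∈ Finset.Ioc lo hi
  swap
  · have h1 : ∀ x ∈ Finset.Ioc lo hi, Function.update y p h.2 x = y x := fun x hx =>
      Function.update_of_ne (by rintro rfl; exact hpW hx) _ _
    exact ⟨fun h => h.congr h1, fun h => h.congr fun x hx => (h1 x hx).symm⟩
  have hrm := mem_rectDiagram.1 hr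
  dsimp only at hrm
  -- In the column of the empty cell, the labels below it are larger than `p`.
  have hbig : ∀ i, h.1 < i → i < R → p < F (i, h.2) := by
    intro i hi1 hi2
    have hbm : (h.1 + 1, h.2) ∈ rectDiagram R C := mem_rectDiagram.2 ⟨by dsimp only; omega,
      by dsimp only; omega⟩
    refine (hb hbm).trans_le ?_
    rcases (Nat.succ_le_of_lt hi1).eq_or_lt with h1 | h1
    · rw [← h1]
    · exact (hF.lt (h.1 + 1, h.2) (i, h.2) ⟨hi1, le_rfl⟩ (fun e => h1.ne (congrArg Prod.fst e))
        (fun e => Nat.succ_ne_self _ (congrArg Prod.fst e))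
        (fun e => hi1.ne' (congrArg Prod.fst e)) (mem_rectDiagram.2 ⟨hi2, by dsimp only; omega⟩)).le
  rw [Finset.mem_Ioc] at hpW
  refine _root_.hasDecFamily_update_iff (Nat.covBy_iff_add_one_eq.2 rfl) (hy _ hr hnr)
    (fun q => ?_) (fun q => ?_)
  · set I := (Finset.range R).filter fun i => h.1 < i ∧ F (i, h.2 + 1) ≤ min q hi with hI
    refine (Finset.card_le_card (t := I.image fun i => F (i, h.2 + 1)) ?_).trans
      (Finset.card_image_le.trans ?_)
    · intro x hx
      obtain ⟨hxW, hpx, hxq, hyx⟩ := Finset.mem_filter.1 hx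
      obtain ⟨⟨i, j⟩, hm, hne, rfl⟩ := hcell x hxW
      rw [hy _ hm hne] at hyx
      dsimp only at hyx
      subst hyx
      have him := (mem_rectDiagram.1 hm).1
      dsimp only at him
      refine Finset.mem_image.2 ⟨i, ?_, rfl⟩
      rw [hI, Finset.mem_filter, Finset.mem_range]
      refine ⟨him, ?_, le_min hxq (Finset.mem_Ioc.1 hxW).2⟩
      by_contra hcon
      rcases (not_lt.1 hcon).eq_or_lt with h1 | h1
      · rw [h1] at hpx
        exact lt_irrefl _ hpx
      · exact lt_asymm hpx (hF.lt _ _ ⟨h1.le, le_rfl⟩ (fun e => h1.ne (congrArg Prod.fst e)) hne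
          hnr hr)
    · have hlt : ∀ i ∈ I, (i, h.2) ≠ h ∧ p < F (i, h.2) ∧ F (i, h.2) < F (i, h.2 + 1) ∧ i < R ∧
          F (i, h.2 + 1) ≤ min q hi := by
        intro i hi'
        rw [hI, Finset.mem_filter, Finset.mem_range] at hi'
        have h1 : (i, h.2) ≠ h := fun e => hi'.2.1.ne' (congrArg Prod.fst e)
        refine ⟨h1, hbig i hi'.2.1 hi'.1, ?_, hi'.1, hi'.2.2⟩
        exact hF.lt _ _ ⟨le_rfl, Nat.le_succ _⟩ (fun e => Nat.succ_ne_self _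
          (congrArg Prod.snd e).symm) h1 (fun e => Nat.succ_ne_self _ (congrArg Prod.snd e))
          (mem_rectDiagram.2 ⟨hi'.1, hrm.2⟩)
      refine Finset.card_le_card_of_injOn (fun i => F (i, h.2)) (fun i hi' => ?_)
        fun i hi' i' hi'' e => ?_
      · obtain ⟨h1, h2, h3, h4, h5⟩ := hlt i hi'
        have h6 := le_min_iff.1 h5
        rw [Finset.mem_coe, Finset.mem_filter, Finset.mem_Ioc]
        dsimp only
        refine ⟨⟨by omega, by omega⟩, h2, by omega, ?_⟩
        exact hy _ (mem_rectDiagram.2 ⟨h4, by dsimp only; omega⟩) h1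
      · obtain ⟨h1, -, -, h4, -⟩ := hlt i hi'
        obtain ⟨h1', -, -, h4', -⟩ := hlt i' hi''
        exact congrArg Prod.fst (hF.bij.injOn
          (show (i, h.2) ∈ {p | p ∈ rectDiagram R C ∧ p ≠ h} from
            ⟨mem_rectDiagram.2 ⟨h4, by dsimp only; omega⟩, h1⟩)
          (show (i', h.2) ∈ {p | p ∈ rectDiagram R C ∧ p ≠ h} from
            ⟨mem_rectDiagram.2 ⟨h4', by dsimp only; omega⟩, h1'⟩) e)
  · set I := (Finset.range R).filter fun i => i < h.1 ∧ max q (lo + 1) ≤ F (i, h.2) with hI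
    refine (Finset.card_le_card (t := I.image fun i => F (i, h.2)) ?_).trans
      (Finset.card_image_le.trans ?_)
    · intro x hx
      obtain ⟨hxW, hxp, hqx, hyx⟩ := Finset.mem_filter.1 hx
      obtain ⟨⟨i, j⟩, hm, hne, rfl⟩ := hcell x hxW
      rw [hy _ hm hne] at hyx
      dsimp only at hyx
      subst hyx
      have him := (mem_rectDiagram.1 hm).1
      dsimp only at him
      refine Finset.mem_image.2 ⟨i, ?_, rfl⟩
      rw [hI, Finset.mem_filter, Finset.mem_range]
      refine ⟨him, ?_, max_le hqx (Finset.mem_Ioc.1 hxW).1⟩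
      by_contra hcon
      rcases (not_lt.1 hcon).eq_or_lt with h1 | h1
      · exact hne (Prod.ext h1.symm rfl)
      · exact lt_asymm hxp (hbig i h1 him)
    · have hlt : ∀ i ∈ I, (i, h.2 + 1) ≠ h ∧ F (i, h.2 + 1) < p ∧ F (i, h.2) < F (i, h.2 + 1) ∧
          i < R ∧ max q (lo + 1) ≤ F (i, h.2) := by
        intro i hi'
        rw [hI, Finset.mem_filter, Finset.mem_range] at hi'
        have h1 : (i, h.2 + 1) ≠ h := fun e => hi'.2.1.ne (congrArg Prod.fst e)
        refine ⟨h1, ?_, ?_, hi'.1, hi'.2.2⟩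
        · exact hF.lt _ _ ⟨hi'.2.1.le, le_rfl⟩ (fun e => hi'.2.1.ne (congrArg Prod.fst e)) h1
            hnr hr
        · exact hF.lt _ _ ⟨le_rfl, Nat.le_succ _⟩ (fun e => Nat.succ_ne_self _
            (congrArg Prod.snd e).symm) (fun e => hi'.2.1.ne (congrArg Prod.fst e)) h1
            (mem_rectDiagram.2 ⟨hi'.1, hrm.2⟩)
      refine Finset.card_le_card_of_injOn (fun i => F (i, h.2 + 1)) (fun i hi' => ?_)
        fun i hi' i' hi'' e => ?_
      · obtain ⟨h1, h2, h3, h4, h5⟩ := hlt i hi'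
        have h6 := max_le_iff.1 h5
        rw [Finset.mem_coe, Finset.mem_filter, Finset.mem_Ioc]
        dsimp only
        refine ⟨⟨by omega, by omega⟩, h2, by omega, ?_⟩
        exact hy _ (mem_rectDiagram.2 ⟨h4, hrm.2⟩) h1
      · obtain ⟨h1, -, -, h4, -⟩ := hlt i hi'
        obtain ⟨h1', -, -, h4', -⟩ := hlt i' hi''
        exact congrArg Prod.fst (hF.bij.injOn
          (show (i, h.2 + 1) ∈ {p | p ∈ rectDiagram R C ∧ p ≠ h} from
            ⟨mem_rectDiagram.2 ⟨h4, hrm.2⟩, h1⟩)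
          (show (i', h.2 + 1) ∈ {p | p ∈ rectDiagram R C ∧ p ≠ h} from
            ⟨mem_rectDiagram.2 ⟨h4', hrm.2⟩, h1'⟩) e)

theorem exists_col_slid {s : ℕ} (hT : IsFilling R C s T) (h0 : (0, 0) ∈ rectDiagram R C)
    {y₀ : ℕ → ℕ} (hy₀ : ∀ q ∈ rectDiagram R C, y₀ (T q.1 q.2) = q.2) {lo hi : ℕ}
    (hlo : s + 1 ≤ lo) (hhi : hi ≤ s + R * C) (t : ℕ) :
    ∃ y : ℕ → ℕ, (∀ q ∈ rectDiagram R C, q ≠ hole (rectDiagram R C) T t →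
        y (slid (rectDiagram R C) T t q) = q.2) ∧
      ∀ m v, HasDecFamily y (Finset.Ioc lo hi) m v ↔ HasDecFamily y₀ (Finset.Ioc lo hi) m v := by
  induction t with
  | zero => exact ⟨y₀, fun q hq _ => by rw [slid_zero]; exact hy₀ q hq, fun _ _ => Iff.rfl⟩
  | succ t ih =>
    obtain ⟨y, hy, hyW⟩ := ih
    have hF := isPuncturedFilling_slid hT h0 t
    have hs := slid_succ (rectDiagram R C) T t
    rw [hole_succ] at hs ⊢
    set h := hole (rectDiagram R C) T t with hh
    have hbelow : slid (rectDiagram R C) T t (h.1 + 1, h.2) = T (h.1 + 1) h.2 :=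
      slid_of_not_le h0 fun h' => absurd h'.1 (Nat.not_succ_le_self _)
    have hright : slid (rectDiagram R C) T t (h.1, h.2 + 1) = T h.1 (h.2 + 1) :=
      slid_of_not_le h0 fun h' => absurd h'.2 (Nat.not_succ_le_self _)
    have hnb : (h.1 + 1, h.2) ≠ h := fun e => Nat.succ_ne_self _ (congrArg Prod.fst e)
    have hnr : (h.1, h.2 + 1) ≠ h := fun e => Nat.succ_ne_self _ (congrArg Prod.snd e)
    rcases nextHole_cases T hF.mem with ⟨h1, h2, h3⟩ | ⟨h1, h2, h3⟩ | ⟨h1, h2, h3⟩ <;>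
      rw [h1] at hs ⊢ <;> rw [hs]
    · refine ⟨y, fun q hq hne => ?_, hyW⟩
      rcases eq_or_ne q h with rfl | hqh
      · rw [Function.update_self]
        dsimp only
        rw [← hbelow]
        exact hy _ h2 hnb
      · rw [Function.update_of_ne hqh]
        exact hy q hq hqh
    · refine ⟨Function.update y (slid (rectDiagram R C) T t (h.1, h.2 + 1)) h.2,
        fun q hq hne => ?_, fun m v => ?_⟩
      · rcases eq_or_ne q h with hqh | hqh
        · rw [hqh, Function.update_self, hright, Function.update_self]
        · rw [Function.update_of_ne hqh, Function.update_of_ne]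
          · exact hy q hq hqh
          · exact fun e => hne (hF.bij.injOn ⟨hq, hqh⟩ ⟨h2, hnr⟩ e)
      · rw [hF.hasDecFamily_update_iff h2 (fun hbm => ?_) hy hlo hhi, hyW]
        refine lt_of_le_of_ne ?_ fun e =>
          Nat.succ_ne_self _ (congrArg Prod.snd (hF.bij.injOn ⟨h2, hnr⟩ ⟨hbm, hnb⟩ e))
        rw [hright, hbelow]
        exact h3 hbm
    · refine ⟨y, fun q hq hne => ?_, hyW⟩
      rw [Function.update_of_ne hne]
      exact hy q hq hne

end Path

/-! ### Gromotion and Greene's invariants of windows of labels -/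

section Gromotion

variable {R C : ℕ} {T : ℕ → ℕ → ℕ}

theorem gromotion_of_ne_corner {p : ℕ × ℕ} (hp : p ∈ rectDiagram R C) (hne : p ≠ (R - 1, C - 1)) :
    gromotion (rectDiagram R C) T p.1 p.2 = slid (rectDiagram R C) T (R * C) p := by
  have h : nextHole (rectDiagram R C) T (p.1, p.2) ≠ (p.1, p.2) := by
    rcases nextHole_cases T hp with h | h | h
    · rw [h.1]; exact fun e => Nat.succ_ne_self _ (congrArg Prod.fst e)
    · rw [h.1]; exact fun e => Nat.succ_ne_self _ (congrArg Prod.snd e)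
    · refine absurd (Prod.ext ?_ ?_) hne <;> dsimp only <;> omega
  rw [gromotion, slid, card_rectDiagram, if_neg h]

theorem gromotion_corner (h0 : (0, 0) ∈ rectDiagram R C) :
    gromotion (rectDiagram R C) T (R - 1) (C - 1) = T 0 0 + R * C := by
  have hm := mem_rectDiagram.1 h0
  dsimp only at hm
  have hle : R + C - 2 < R * C := by
    obtain ⟨a, rfl⟩ := Nat.exists_eq_add_of_lt hm.1
    obtain ⟨b, rfl⟩ := Nat.exists_eq_add_of_lt hm.2
    ring_nf
    omega
  have h1 := hole_eq_corner (T := T) h0 le_rfl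
  have h2 : nextHole (rectDiagram R C) T (R - 1, C - 1) = (R - 1, C - 1) := by
    rw [← h1, ← hole_succ, hole_eq_corner h0 (Nat.le_succ _), hole_eq_corner h0 le_rfl]
  rw [gromotion, card_rectDiagram, if_pos ⟨_, hle, h1⟩, if_pos h2]

theorem IsFilling.isPuncturedFilling_gromotion {s : ℕ} (hT : IsFilling R C s T)
    (h0 : (0, 0) ∈ rectDiagram R C) :
    IsPuncturedFilling R C s (R - 1, C - 1)
      (fun p => gromotion (rectDiagram R C) T p.1 p.2) := by
  have hm := mem_rectDiagram.1 h0
  dsimp only at hm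
  have hle : R + C - 2 ≤ R * C := by
    obtain ⟨a, rfl⟩ := Nat.exists_eq_add_of_lt hm.1
    obtain ⟨b, rfl⟩ := Nat.exists_eq_add_of_lt hm.2
    ring_nf
    omega
  have h := isPuncturedFilling_slid hT h0 (R * C)
  rw [hole_eq_corner h0 hle] at h
  refine ⟨h.mem, fun p q hpq hne hp hq hqm => ?_, h.bij.congr fun p hp => ?_⟩
  · rw [gromotion_of_ne_corner (mem_rectDiagram_of_le hpq hqm) hp, gromotion_of_ne_corner hqm hq]
    exact h.lt p q hpq hne hp hq hqm
  · exact (gromotion_of_ne_corner hp.1 hp.2).symm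

theorem IsFilling.gromotion {s : ℕ} (hT : IsFilling R C s T) (h0 : (0, 0) ∈ rectDiagram R C) :
    IsFilling R C (s + 1) (gromotion (rectDiagram R C) T) := by
  have hF := hT.isPuncturedFilling_gromotion h0
  have hc := gromotion_corner (T := T) h0
  rw [hT.apply_zero h0] at hc
  have hm := mem_rectDiagram.1 h0
  dsimp only at hm
  have hpos : 0 < R * C := Nat.mul_pos hm.1 hm.2
  have hval : ∀ p, p ∈ rectDiagram R C → p ≠ (R - 1, C - 1) →
      s + 1 < _root_.gromotion (rectDiagram R C) T p.1 p.2 ∧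
      _root_.gromotion (rectDiagram R C) T p.1 p.2 ≤ s + R * C :=
    fun p hp hne => hF.bij.mapsTo ⟨hp, hne⟩
  refine ⟨fun p q hpq hne hqm => ?_, fun p hp => ?_, fun p hp q hq e => ?_, fun x hx => ?_⟩
  · have hpm := mem_rectDiagram_of_le hpq hqm
    have hpc : p ≠ (R - 1, C - 1) := by
      rintro rfl
      have h1 := mem_rectDiagram.1 hqm
      refine hne (Prod.ext (le_antisymm hpq.1 ?_) (le_antisymm hpq.2 ?_)) <;> dsimp only <;> omega
    by_cases hqc : q = (R - 1, C - 1)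
    · have := hval p hpm hpc
      rw [hqc, hc]
      omega
    · exact hF.lt p q hpq hne hpc hqc hqm
  · rw [Set.mem_Ioc]
    dsimp only
    by_cases hpc : p = (R - 1, C - 1)
    · rw [hpc, hc]
      omega
    · have := hval p hp hpc
      omega
  · dsimp only at e
    by_cases hpc : p = (R - 1, C - 1) <;> by_cases hqc : q = (R - 1, C - 1)
    · rw [hpc, hqc]
    · have := hval q hq hqc
      rw [hpc, hc] at e
      omega
    · have := hval p hp hpc
      rw [hqc, hc] at e
      omega
    · exact hF.bij.injOn ⟨hp, hpc⟩ ⟨hq, hqc⟩ e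
  · rw [Set.mem_Ioc] at hx
    by_cases hxc : x = s + 1 + R * C
    · exact ⟨_, hF.mem, hc.trans hxc.symm⟩
    · obtain ⟨q, hq, hqx⟩ := hF.bij.surjOn (show x ∈ Set.Ioc (s + 1) (s + R * C) from
        ⟨hx.1, by omega⟩)
      exact ⟨q, hq.1, hqx⟩

/-- The (index of the) column of the filling `T` that contains the label `x`. As a word in `x`, it
lists the columns of the labels. -/
noncomputable def colOf (R C : ℕ) (T : ℕ → ℕ → ℕ) (x : ℕ) : ℕ :=
  open Classical in
  if h : ∃ q : ℕ × ℕ, q ∈ rectDiagram R C ∧ T q.1 q.2 = x then h.choose.2 else 0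

theorem IsFilling.colOf_apply {s : ℕ} (hT : IsFilling R C s T) {q : ℕ × ℕ}
    (hq : q ∈ rectDiagram R C) : colOf R C T (T q.1 q.2) = q.2 := by
  have h : ∃ q' : ℕ × ℕ, q' ∈ rectDiagram R C ∧ T q'.1 q'.2 = T q.1 q.2 := ⟨q, hq, rfl⟩
  rw [colOf, dif_pos h]
  exact congrArg Prod.snd (hT.bij.injOn h.choose_spec.1 hq h.choose_spec.2)

theorem IsFilling.hasDecFamily_gromotion_iff {s : ℕ} (hT : IsFilling R C s T)
    (h0 : (0, 0) ∈ rectDiagram R C) {lo hi : ℕ} (hlo : s + 1 ≤ lo) (hhi : hi ≤ s + R * C)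
    {m v : ℕ} :
    HasDecFamily (colOf R C (_root_.gromotion (rectDiagram R C) T)) (Finset.Ioc lo hi) m v ↔
      HasDecFamily (colOf R C T) (Finset.Ioc lo hi) m v := by
  obtain ⟨y, hy, hyW⟩ := exists_col_slid hT h0 (fun q hq => hT.colOf_apply hq) hlo hhi (R * C)
  have hm := mem_rectDiagram.1 h0
  dsimp only at hm
  have hle : R + C - 2 ≤ R * C := by
    obtain ⟨a, rfl⟩ := Nat.exists_eq_add_of_lt hm.1
    obtain ⟨b, rfl⟩ := Nat.exists_eq_add_of_lt hm.2
    ring_nf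
    omega
  rw [hole_eq_corner h0 hle] at hy
  have hF := hT.isPuncturedFilling_gromotion h0
  have hcol : ∀ x ∈ Finset.Ioc lo hi,
      colOf R C (_root_.gromotion (rectDiagram R C) T) x = y x := by
    intro x hx
    rw [Finset.mem_Ioc] at hx
    obtain ⟨q, ⟨hq, hne⟩, rfl⟩ := hF.bij.surjOn (show x ∈ Set.Ioc (s + 1) (s + R * C) from
      ⟨by omega, by omega⟩)
    dsimp only
    rw [(hT.gromotion h0).colOf_apply hq, gromotion_of_ne_corner hq hne, hy q hq hne]
  rw [← hyW m v]
  exact ⟨fun h => h.congr hcol, fun h => h.congr fun x hx => (hcol x hx).symm⟩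

theorem IsFilling.iterate {s : ℕ} (hT : IsFilling R C s T) (h0 : (0, 0) ∈ rectDiagram R C)
    (k : ℕ) : IsFilling R C (s + k) ((_root_.gromotion (rectDiagram R C))^[k] T) := by
  induction k with
  | zero => exact hT
  | succ k ih =>
    rw [Function.iterate_succ_apply']
    exact ih.gromotion h0

theorem IsFilling.hasDecFamily_iterate_iff {s : ℕ} (hT : IsFilling R C s T)
    (h0 : (0, 0) ∈ rectDiagram R C) {k lo hi : ℕ} (hlo : s + k ≤ lo) (hhi : hi ≤ s + R * C)
    {m v : ℕ} :
    HasDecFamily (colOf R C ((_root_.gromotion (rectDiagram R C))^[k] T)) (Finset.Ioc lo hi) m v ↔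
      HasDecFamily (colOf R C T) (Finset.Ioc lo hi) m v := by
  induction k with
  | zero => rfl
  | succ k ih =>
    rw [Function.iterate_succ_apply',
      (hT.iterate h0 k).hasDecFamily_gromotion_iff h0 (by omega) (by omega), ih (by omega)]

/-- Greene's invariants of a window of labels, if the cells of the window are right-justified in the
rows of index less than `r`, left-justified in the other rows, and the labels of the former
rows are smaller than those of the latter: the last `m` cells of the former rows and the first
`m` cells of the latter form an optimal family, since the labels of one row increase along the
columns and hence have different colours in any family. -/
theorem IsFilling.hasDecFamily_colOf_iff {s : ℕ} (hT : IsFilling R C s T) {r lo mid hi m v : ℕ}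
    (hlo : s ≤ lo) (hlm : lo ≤ mid) (hmh : mid ≤ hi) (hhi : hi ≤ s + R * C) (hm : m ≤ C)
    (htop : ∀ i < R, i < r → ∀ j < C, T i j ≤ mid)
    (hbot : ∀ i < R, r ≤ i → ∀ j < C, mid < T i j) :
    HasDecFamily (colOf R C T) (Finset.Ioc lo hi) m v ↔
      v ≤ ((rectDiagram R C).cells.filter fun q => (lo < T q.1 q.2 ∧ T q.1 q.2 ≤ hi) ∧
        if q.1 < r then C ≤ q.2 + m else q.2 < m).card := by
  set O := (rectDiagram R C).cells.filter fun q => (lo < T q.1 q.2 ∧ T q.1 q.2 ≤ hi) ∧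
        if q.1 < r then C ≤ q.2 + m else q.2 < m with hO
  have hmemO : ∀ q, q ∈ O ↔ (q.1 < R ∧ q.2 < C) ∧ (lo < T q.1 q.2 ∧ T q.1 q.2 ≤ hi) ∧
      if q.1 < r then C ≤ q.2 + m else q.2 < m := by
    intro q
    rw [hO, Finset.mem_filter, YoungDiagram.mem_cells, mem_rectDiagram]
  have hinj : ∀ p q : ℕ × ℕ, p.1 < R ∧ p.2 < C → q.1 < R ∧ q.2 < C →
      T p.1 p.2 = T q.1 q.2 → p = q := fun p q hp hq e =>
    hT.bij.injOn (mem_rectDiagram.2 hp) (mem_rectDiagram.2 hq) e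
  have hcol : ∀ q : ℕ × ℕ, q.1 < R ∧ q.2 < C → colOf R C T (T q.1 q.2) = q.2 := fun q hq =>
    hT.colOf_apply (mem_rectDiagram.2 hq)
  have hrow : ∀ i j j', i < R → j < j' → j' < C → T i j < T i j' := fun i j j' hi hj hj' =>
    hT.lt (i, j) (i, j') ⟨le_rfl, hj.le⟩ (fun e => hj.ne (congrArg Prod.snd e))
      (mem_rectDiagram.2 ⟨hi, hj'⟩)
  have hmid : ∀ q : ℕ × ℕ, q.1 < R ∧ q.2 < C → (T q.1 q.2 ≤ mid ↔ q.1 < r) := by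
    intro q hq
    refine ⟨fun h => ?_, fun h => htop _ hq.1 h _ hq.2⟩
    by_contra h'
    exact absurd (hbot _ hq.1 (not_lt.1 h') _ hq.2) (not_lt.2 h)
  constructor
  · rintro ⟨A, hA, f, ⟨hf, hdec⟩, hv⟩
    refine hv.trans ?_
    set B := (rectDiagram R C).cells.filter fun q => T q.1 q.2 ∈ A with hB
    have hmemB : ∀ q, q ∈ B ↔ (q.1 < R ∧ q.2 < C) ∧ T q.1 q.2 ∈ A := by
      intro q
      rw [hB, Finset.mem_filter, YoungDiagram.mem_cells, mem_rectDiagram]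
    have hAB : A ⊆ B.image fun q => T q.1 q.2 := by
      intro x hx
      have hx' := Finset.mem_Ioc.1 (hA hx)
      obtain ⟨q, hq, rfl⟩ := hT.bij.surjOn (show x ∈ Set.Ioc s (s + R * C) from
        ⟨by omega, by omega⟩)
      exact Finset.mem_image.2 ⟨q, (hmemB q).2 ⟨mem_rectDiagram.1 hq, hx⟩, rfl⟩
    refine ((Finset.card_le_card hAB).trans Finset.card_image_le).trans ?_
    rw [Finset.card_eq_sum_card_fiberwise (f := Prod.fst) (t := Finset.range R)
        (fun q hq => Finset.mem_coe.2 (Finset.mem_range.2 ((hmemB q).1 hq).1.1)),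
      Finset.card_eq_sum_card_fiberwise (s := O) (f := Prod.fst) (t := Finset.range R)
        (fun q hq => Finset.mem_coe.2 (Finset.mem_range.2 ((hmemO q).1 hq).1.1))]
    refine Finset.sum_le_sum fun i hi' => ?_
    rw [Finset.mem_range] at hi'
    by_cases hsub : (B.filter fun q => q.1 = i) ⊆ O.filter fun q => q.1 = i
    · exact Finset.card_le_card hsub
    · -- Both sides are compared with `m`.
      have h1 : (B.filter fun q => q.1 = i).card ≤ (Finset.range m).card := by
        refine Finset.card_le_card_of_injOn (fun q => f (T q.1 q.2)) (fun q hq => ?_)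
          fun p hp q hq e => ?_
        · have := (hmemB q).1 (Finset.mem_filter.1 hq).1
          exact Finset.mem_coe.2 (Finset.mem_range.2 (hf _ this.2))
        · obtain ⟨hp1, hp2⟩ := Finset.mem_filter.1 hp
          obtain ⟨hq1, hq2⟩ := Finset.mem_filter.1 hq
          rw [hmemB] at hp1 hq1
          refine Prod.ext (hp2.trans hq2.symm) ?_
          have key : ∀ p q : ℕ × ℕ, ((p.1 < R ∧ p.2 < C) ∧ T p.1 p.2 ∈ A) → p.1 = i →
              ((q.1 < R ∧ q.2 < C) ∧ T q.1 q.2 ∈ A) → q.1 = i →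
              f (T p.1 p.2) = f (T q.1 q.2) → ¬p.2 < q.2 := by
            intro p q hp1 hp2 hq1 hq2 e hlt
            have h2 : T p.1 p.2 < T q.1 q.2 := by
              rw [hp2, hq2]
              exact hrow i _ _ hi' hlt hq1.1.2
            have h3 := hdec _ hp1.2 _ hq1.2 h2 e
            rw [hcol p hp1.1, hcol q hq1.1] at h3
            omega
          have h4 := key p q hp1 hp2 hq1 hq2 e
          have h5 := key q p hq1 hq2 hp1 hp2 e.symm
          omega
      refine h1.trans ?_
      obtain ⟨q, hq, hqO⟩ := Finset.not_subset.1 hsub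
      obtain ⟨hqB, rfl⟩ := Finset.mem_filter.1 hq
      rw [hmemB] at hqB
      have hqW := Finset.mem_Ioc.1 (hA hqB.2)
      rw [Finset.mem_filter, hmemO, not_and_or] at hqO
      have hqO' := (not_and.1 (not_and.1 (hqO.resolve_right fun h => h rfl) hqB.1)) hqW
      by_cases hqr : q.1 < r
      · rw [if_pos hqr] at hqO'
        refine Finset.card_le_card_of_injOn (fun t => (q.1, C - m + t)) (fun t ht => ?_)
          fun t _ t' _ e => ?_
        · rw [Finset.mem_coe, Finset.mem_range] at ht
          rw [Finset.mem_coe, Finset.mem_filter, hmemO]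
          dsimp only
          rw [if_pos hqr]
          have h2 := htop q.1 hi' hqr (C - m + t) (by omega)
          have h3 := hrow q.1 q.2 (C - m + t) hi' (by omega) (by omega)
          omega
        · have := congrArg Prod.snd e
          dsimp only at this
          omega
      · rw [if_neg hqr] at hqO'
        refine Finset.card_le_card_of_injOn (fun t => (q.1, t)) (fun t ht => ?_)
          fun t _ t' _ e => ?_
        · rw [Finset.mem_coe, Finset.mem_range] at ht
          rw [Finset.mem_coe, Finset.mem_filter, hmemO]
          dsimp only
          rw [if_neg hqr]
          have h2 := hbot q.1 hi' (not_lt.1 hqr) t (by omega)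
          have h3 := hrow q.1 t q.2 hi' (by omega) hqB.1.2
          omega
        · exact congrArg Prod.snd e
  · intro hv
    refine ⟨O.image fun q => T q.1 q.2, ?_, fun x => if x ≤ mid then colOf R C T x + m - C
      else colOf R C T x, ⟨?_, ?_⟩, ?_⟩
    · intro x hx
      obtain ⟨q, hq, rfl⟩ := Finset.mem_image.1 hx
      exact Finset.mem_Ioc.2 ((hmemO q).1 hq).2.1
    · intro x hx
      obtain ⟨q, hq, rfl⟩ := Finset.mem_image.1 hx
      obtain ⟨h1, h2, h3⟩ := (hmemO q).1 hq
      dsimp only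
      rw [hcol q h1]
      simp only [hmid q h1]
      split_ifs at h3 ⊢ <;> omega
    · intro x hx x' hx' hlt hfx
      obtain ⟨q, hq, rfl⟩ := Finset.mem_image.1 hx
      obtain ⟨h1, h2, h3⟩ := (hmemO q).1 hq
      obtain ⟨q', hq', rfl⟩ := Finset.mem_image.1 hx'
      obtain ⟨h1', h2', h3'⟩ := (hmemO q').1 hq'
      dsimp only at hlt hfx
      have hmq := hmid q h1
      have hmq' := hmid q' h1'
      rw [hcol q h1, hcol q' h1'] at hfx ⊢
      split_ifs at h3 h3' hfx <;> omega
    · rw [Finset.card_image_of_injOn]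
      · exact hv
      · intro p hp q hq e
        exact hinj p q ((hmemO p).1 hp).1 ((hmemO q).1 hq).1 e

end Gromotion

/-! ### Gromotion of stacked fillings -/

/-- In passing from `m` to `m + 1`, one cell is added to each row. -/
theorem card_filter_cells_succ {R C r m : ℕ} (hm : m < C) (P : ℕ × ℕ → Prop) [DecidablePred P] :
    ((rectDiagram R C).cells.filter fun q =>
        P q ∧ if q.1 < r then C ≤ q.2 + (m + 1) else q.2 < m + 1).card =
      ((rectDiagram R C).cells.filter fun q =>
        P q ∧ if q.1 < r then C ≤ q.2 + m else q.2 < m).card +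
      ((Finset.range R).filter fun i => P (i, if i < r then C - 1 - m else m)).card := by
  have hmem : ∀ (q : ℕ × ℕ) m', q ∈ ((rectDiagram R C).cells.filter fun q =>
      P q ∧ if q.1 < r then C ≤ q.2 + m' else q.2 < m') ↔
      (q.1 < R ∧ q.2 < C) ∧ P q ∧ if q.1 < r then C ≤ q.2 + m' else q.2 < m' := fun q m' => by
    rw [Finset.mem_filter, YoungDiagram.mem_cells, mem_rectDiagram]
  rw [← Finset.card_image_of_injective ((Finset.range R).filter fun i =>
      P (i, if i < r then C - 1 - m else m))
      (f := fun i => (i, if i < r then C - 1 - m else m)) fun i i' e => congrArg Prod.fst e,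
    ← Finset.card_union_of_disjoint]
  · congr 1
    ext ⟨i, j⟩
    rw [Finset.mem_union, hmem, hmem, Finset.mem_image]
    simp only [Finset.mem_filter, Finset.mem_range, Prod.mk.injEq]
    constructor
    · rintro ⟨⟨hi, hj⟩, hP, h⟩
      by_cases hj' : j = if i < r then C - 1 - m else m
      · exact Or.inr ⟨i, ⟨hi, hj' ▸ hP⟩, rfl, hj'.symm⟩
      · refine Or.inl ⟨⟨hi, hj⟩, hP, ?_⟩
        split_ifs at h hj' ⊢ <;> omega
    · rintro (⟨⟨hi, hj⟩, hP, h⟩ | ⟨i', ⟨hi, hP⟩, rfl, rfl⟩)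
      · refine ⟨⟨hi, hj⟩, hP, ?_⟩
        split_ifs at h ⊢ <;> omega
      · refine ⟨⟨hi, ?_⟩, hP, ?_⟩ <;> split_ifs <;> omega
  · rw [Finset.disjoint_left]
    intro q hq hq'
    rw [hmem] at hq
    obtain ⟨i, -, rfl⟩ := Finset.mem_image.1 hq'
    have h := hq.2.2
    dsimp only at h
    split_ifs at h <;> omega

/-- For an increasing sequence, the terms that are at most `x` are counted by the index of the first
larger one. -/
theorem le_iff_lt_card_filter {g : ℕ → ℕ} {N a x : ℕ} (hg : ∀ i j, i < j → j < N → g i < g j)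
    (ha : a < N) : g a ≤ x ↔ a < ((Finset.range N).filter fun i => g i ≤ x).card := by
  have hg' : ∀ i j, i ≤ j → j < N → g i ≤ g j := fun i j hij hj => by
    rcases hij.eq_or_lt with rfl | h
    · exact le_rfl
    · exact (hg i j h hj).le
  constructor
  · intro h
    refine (Finset.card_range (a + 1)).symm.trans_le ?_
    refine Finset.card_le_card fun i hi => ?_
    rw [Finset.mem_range] at hi
    rw [Finset.mem_filter, Finset.mem_range]
    exact ⟨by omega, (hg' i a (by omega) ha).trans h⟩
  · intro h
    by_contra hcon
    refine absurd h (not_lt.2 ?_)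
    conv_rhs => rw [← Finset.card_range a]
    refine Finset.card_le_card fun i hi => ?_
    rw [Finset.mem_filter, Finset.mem_range] at hi
    rw [Finset.mem_range]
    by_contra h'
    exact hcon ((hg' a i (by omega) hi.1).trans hi.2)

theorem card_filter_le_apply {g : ℕ → ℕ} {N a : ℕ} (hg : ∀ i j, i < j → j < N → g i < g j)
    (ha : a < N) : ((Finset.range N).filter fun i => g i ≤ g a).card = a + 1 := by
  refine le_antisymm ?_ ((le_iff_lt_card_filter hg ha).1 le_rfl)
  rcases Nat.lt_or_ge (a + 1) N with h | h
  · exact not_lt.1 fun h' =>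
      absurd ((le_iff_lt_card_filter hg h).2 h') (not_le.2 (hg _ _ a.lt_succ_self h))
  · exact (Finset.card_filter_le _ _).trans (by rw [Finset.card_range]; exact h)

theorem card_filter_le_apply_sub_one {g : ℕ → ℕ} {N a : ℕ}
    (hg : ∀ i j, i < j → j < N → g i < g j) (ha : a < N) (hpos : 0 < g a) :
    ((Finset.range N).filter fun i => g i ≤ g a - 1).card = a := by
  refine le_antisymm (not_lt.1 fun h => ?_) (not_lt.1 fun h => ?_)
  · have := (le_iff_lt_card_filter hg ha).2 h
    omega
  · have h1 := le_iff_lt_card_filter (x := g a - 1) hg (h.trans ha)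
    have h2 := hg _ _ h ha
    exact lt_irrefl _ (h1.1 (by omega))

theorem IsFilling.col_lt {R C s : ℕ} {T : ℕ → ℕ → ℕ} (hT : IsFilling R C s T) {j : ℕ}
    (hj : j < C) (i i' : ℕ) (hi : i < i') (hi' : i' < R) : T i j < T i' j :=
  hT.lt (i, j) (i', j) ⟨hi.le, le_rfl⟩ (fun e => hi.ne (congrArg Prod.fst e))
    (mem_rectDiagram.2 ⟨hi', hj⟩)

theorem IsFilling.mem_Ioc {R C s : ℕ} {T : ℕ → ℕ → ℕ} (hT : IsFilling R C s T) {i j : ℕ}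
    (hi : i < R) (hj : j < C) : s < T i j ∧ T i j ≤ s + R * C :=
  hT.bij.mapsTo (show (i, j) ∈ {p | p ∈ rectDiagram R C} from mem_rectDiagram.2 ⟨hi, hj⟩)

/-- If the window `(lo, hi]` has the shape considered in `IsFilling.hasDecFamily_colOf_iff` for two
fillings with the same Greene invariants, then the columns of the two shapes agree. -/
theorem card_column_eq {R C s s' : ℕ} {T T' : ℕ → ℕ → ℕ} (hT : IsFilling R C s T)
    (hT' : IsFilling R C s' T') {r r' lo mid mid' hi : ℕ}
    (h : ∀ m v, HasDecFamily (colOf R C T) (Finset.Ioc lo hi) m v ↔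
      HasDecFamily (colOf R C T') (Finset.Ioc lo hi) m v)
    (hlo : s ≤ lo) (hlm : lo ≤ mid) (hmh : mid ≤ hi) (hhi : hi ≤ s + R * C)
    (htop : ∀ i < R, i < r → ∀ j < C, T i j ≤ mid)
    (hbot : ∀ i < R, r ≤ i → ∀ j < C, mid < T i j)
    (hlo' : s' ≤ lo) (hlm' : lo ≤ mid') (hmh' : mid' ≤ hi) (hhi' : hi ≤ s' + R * C)
    (htop' : ∀ i < R, i < r' → ∀ j < C, T' i j ≤ mid')
    (hbot' : ∀ i < R, r' ≤ i → ∀ j < C, mid' < T' i j) {m : ℕ} (hm : m < C) :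
    ((Finset.range R).filter fun i => lo < T i (if i < r then C - 1 - m else m) ∧
        T i (if i < r then C - 1 - m else m) ≤ hi).card =
      ((Finset.range R).filter fun i => lo < T' i (if i < r' then C - 1 - m else m) ∧
        T' i (if i < r' then C - 1 - m else m) ≤ hi).card := by
  have key : ∀ m ≤ C, ((rectDiagram R C).cells.filter fun q => (lo < T q.1 q.2 ∧ T q.1 q.2 ≤ hi) ∧
      if q.1 < r then C ≤ q.2 + m else q.2 < m).card =
      ((rectDiagram R C).cells.filter fun q => (lo < T' q.1 q.2 ∧ T' q.1 q.2 ≤ hi) ∧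
      if q.1 < r' then C ≤ q.2 + m else q.2 < m).card := by
    intro m hm
    refine eq_of_forall_le_iff fun v => ?_
    rw [← hT.hasDecFamily_colOf_iff hlo hlm hmh hhi hm htop hbot,
      ← hT'.hasDecFamily_colOf_iff hlo' hlm' hmh' hhi' hm htop' hbot', h]
  have h1 := key m hm.le
  have h2 := key (m + 1) hm
  rw [card_filter_cells_succ hm fun q : ℕ × ℕ => lo < T q.1 q.2 ∧ T q.1 q.2 ≤ hi,
    card_filter_cells_succ hm fun q : ℕ × ℕ => lo < T' q.1 q.2 ∧ T' q.1 q.2 ≤ hi, h1] at h2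
  exact Nat.add_left_cancel h2

/-- A filling of the `2r × c` rectangle whose upper half contains the smaller half of the labels. -/
structure IsStackedFilling (r c s : ℕ) (F : ℕ → ℕ → ℕ) : Prop extends
    IsFilling (2 * r) c s F where
  top : ∀ i < r, ∀ j < c, F i j ≤ s + r * c
  bot : ∀ i < r, ∀ j < c, s + r * c < F (r + i) j

/-- For a stacked filling `F`, the number of labels of the upper half that are left in column `m`
after `k` gromotions: these labels then form the complement of the shape of the first `k` labels,
rotated by 180 degrees. -/
def upperLength (r c s : ℕ) (F : ℕ → ℕ → ℕ) (k m : ℕ) : ℕ :=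
  ((Finset.range r).filter fun i => s + k < F i (c - 1 - m)).card

namespace IsStackedFilling

variable {r c s : ℕ} {F : ℕ → ℕ → ℕ}

theorem zero_mem (hr : 1 ≤ r) (hc : 1 ≤ c) : (0, 0) ∈ rectDiagram (2 * r) c :=
  mem_rectDiagram.2 ⟨by dsimp only; omega, hc⟩

theorem upperLength_add_card (r c s : ℕ) (F : ℕ → ℕ → ℕ) (k m : ℕ) :
    upperLength r c s F k m +
      ((Finset.range r).filter fun i => F i (c - 1 - m) ≤ s + k).card = r := by
  have h := Finset.card_filter_add_card_filter_not (s := Finset.range r)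
    fun i => s + k < F i (c - 1 - m)
  simp only [not_lt, Finset.card_range] at h
  exact h

/-- After at most `r * c` gromotions, the columns of a stacked filling consist of what is left of
its upper half, rotated, with the columns of its lower half attached below. -/
theorem card_column (hF : IsStackedFilling r c s F) (hr : 1 ≤ r) (hc : 1 ≤ c) {k hi m : ℕ}
    (hk : k ≤ r * c) (hlo : s + r * c ≤ hi) (hhi : hi ≤ s + 2 * (r * c)) (hm : m < c) :
    ((Finset.range (2 * r)).filter fun i =>
        (gromotion (rectDiagram (2 * r) c))^[k] F i m ≤ hi).card =
      upperLength r c s F k m + ((Finset.range r).filter fun i => F (r + i) m ≤ hi).card := by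
  have h0 : (0, 0) ∈ rectDiagram (2 * r) c := zero_mem hr hc
  have hFk := hF.toIsFilling.iterate h0 k
  have e : 2 * r * c = 2 * (r * c) := by ring
  have h := card_column_eq (r := 0) (r' := r) (lo := s + k) (mid := s + k) (mid' := s + r * c)
    (hi := hi) hFk hF.toIsFilling (fun m v =>
      hF.toIsFilling.hasDecFamily_iterate_iff h0 le_rfl (by omega)) le_rfl le_rfl (by omega)
    (by omega) (fun i _ hi => absurd hi (Nat.not_lt_zero _))
    (fun i hi _ j hj => (hFk.mem_Ioc hi hj).1) (by omega) (by omega) hlo (by omega)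
    (fun i _ hi j hj => hF.top i hi j hj) (fun i hi hri j hj => by
      obtain ⟨i, rfl⟩ := Nat.exists_eq_add_of_le hri
      exact hF.bot i (by omega) j hj) hm
  refine Eq.trans ?_ (h.trans ?_)
  · congr 1
    refine Finset.filter_congr fun i hi => ?_
    rw [Finset.mem_range] at hi
    simp only [Nat.not_lt_zero, if_false]
    exact ⟨fun h => ⟨(hFk.mem_Ioc hi hm).1, h⟩, fun h => h.2⟩
  · rw [two_mul, Finset.range_eq_Ico, ← Finset.Ico_union_Ico_eq_Ico (Nat.zero_le r)
      (Nat.le_add_right r r), Finset.filter_union, Finset.card_union_of_disjoint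
      (Finset.disjoint_filter_filter (Finset.Ico_disjoint_Ico_consecutive _ _ _))]
    congr 1
    · rw [← Finset.range_eq_Ico, upperLength]
      congr 1
      refine Finset.filter_congr fun i hi => ?_
      rw [Finset.mem_range] at hi
      rw [if_pos hi]
      exact ⟨fun h => h.1, fun h => ⟨h, (hF.top i hi _ (by omega)).trans hlo⟩⟩
    · refine (Finset.card_bij' (fun i _ => i - r) (fun i _ => r + i) ?_ ?_ ?_ ?_)
      · intro i hi
        rw [Finset.mem_filter, Finset.mem_Ico, if_neg (by omega)] at hi
        rw [Finset.mem_filter, Finset.mem_range, Nat.add_sub_cancel' hi.1.1]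
        exact ⟨by omega, hi.2.2⟩
      · intro i hi
        rw [Finset.mem_filter, Finset.mem_range] at hi
        rw [Finset.mem_filter, Finset.mem_Ico, if_neg (by omega)]
        have := hF.bot i hi.1 m hm
        exact ⟨by omega, by omega, hi.2⟩
      · intro i hi
        rw [Finset.mem_filter, Finset.mem_Ico] at hi
        omega
      · intro i hi
        omega

/-- The positions of the labels of the lower half after at most `r * c` gromotions. -/
theorem iterate_apply (hF : IsStackedFilling r c s F) (hr : 1 ≤ r) (hc : 1 ≤ c) {k a m : ℕ}
    (hk : k ≤ r * c) (ha : a < r) (hm : m < c) :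
    (gromotion (rectDiagram (2 * r) c))^[k] F (upperLength r c s F k m + a) m = F (r + a) m := by
  have h0 : (0, 0) ∈ rectDiagram (2 * r) c := zero_mem hr hc
  have hFk := hF.toIsFilling.iterate h0 k
  have hbot := hF.bot a ha m hm
  have hmem := (hF.mem_Ioc (i := r + a) (by omega) hm).2
  have e : 2 * r * c = 2 * (r * c) := by ring
  have hl := upperLength_add_card r c s F k m
  have hg : ∀ i j, i < j → j < r → F (r + i) m < F (r + j) m := fun i j hij hj =>
    hF.toIsFilling.col_lt hm _ _ (by omega) (by omega)
  have h1 := hF.card_column hr hc hk hbot.le (by omega) hm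
  rw [card_filter_le_apply (g := fun i => F (r + i) m) hg ha] at h1
  have h2 := hF.card_column (hi := F (r + a) m - 1) hr hc hk (by omega) (by omega) hm
  rw [card_filter_le_apply_sub_one (g := fun i => F (r + i) m) hg ha (by omega)] at h2
  have h3 := le_iff_lt_card_filter (x := F (r + a) m) (a := upperLength r c s F k m + a)
    (hFk.col_lt hm) (by omega)
  have h4 := le_iff_lt_card_filter (x := F (r + a) m - 1) (a := upperLength r c s F k m + a)
    (hFk.col_lt hm) (by omega)
  rw [h1] at h3
  rw [h2] at h4
  omega

theorem upperLength_eq_zero (hF : IsStackedFilling r c s F) {m : ℕ} (hm : m < c) :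
    upperLength r c s F (r * c) m = 0 := by
  rw [upperLength, Finset.card_eq_zero, Finset.filter_eq_empty_iff]
  intro i hi
  exact not_lt.2 (hF.top i (Finset.mem_range.1 hi) _ (by omega))

theorem iterate_apply_top (hF : IsStackedFilling r c s F) (hr : 1 ≤ r) (hc : 1 ≤ c) {a m : ℕ}
    (ha : a < r) (hm : m < c) :
    (gromotion (rectDiagram (2 * r) c))^[r * c] F a m = F (r + a) m := by
  have h := hF.iterate_apply hr hc le_rfl ha hm
  rwa [hF.upperLength_eq_zero hm, zero_add] at h

/-- After `r * c` gromotions, a stacked filling is again stacked. -/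
theorem iterate (hF : IsStackedFilling r c s F) (hr : 1 ≤ r) (hc : 1 ≤ c) :
    IsStackedFilling r c (s + r * c) ((gromotion (rectDiagram (2 * r) c))^[r * c] F) := by
  have h0 : (0, 0) ∈ rectDiagram (2 * r) c := zero_mem hr hc
  have hFk := hF.toIsFilling.iterate h0 (r * c)
  have e : 2 * r * c = 2 * (r * c) := by ring
  refine ⟨hFk, fun i hi j hj => ?_, fun i hi j hj => ?_⟩
  · rw [hF.iterate_apply_top hr hc hi hj]
    have := (hF.mem_Ioc (i := r + i) (by omega) hj).2
    omega
  · have h1 := hF.card_column (hi := s + 2 * (r * c)) hr hc le_rfl (by omega) le_rfl hj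
    have h2 := le_iff_lt_card_filter (x := s + 2 * (r * c)) (a := r + i) (hFk.col_lt hj)
      (by omega)
    rw [h1, hF.upperLength_eq_zero hj] at h2
    have h3 := Finset.card_filter_le (Finset.range r) fun i => F (r + i) j ≤ s + 2 * (r * c)
    rw [Finset.card_range] at h3
    omega

/-- The upper half returns to its place after all `2 * (r * c)` gromotions. This compares the labels
`s + 2 * (r * c) + 1, …, s + 2 * (r * c) + k`, which are right-justified at the bottom after `k`
gromotions, with their final left-justified position. -/
theorem iterate_iterate_apply (hF : IsStackedFilling r c s F) (hr : 1 ≤ r) (hc : 1 ≤ c) {a m : ℕ}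
    (ha : a < r) (hm : m < c) :
    (gromotion (rectDiagram (2 * r) c))^[r * c + r * c] F a m = F a m + 2 * (r * c) := by
  have h0 : (0, 0) ∈ rectDiagram (2 * r) c := zero_mem hr hc
  have e : 2 * r * c = 2 * (r * c) := by ring
  have hF2 := hF.toIsFilling.iterate h0 (r * c + r * c)
  have key : ∀ k ≤ r * c, ((Finset.range (2 * r)).filter fun i =>
      (gromotion (rectDiagram (2 * r) c))^[r * c + r * c] F i m ≤ s + 2 * (r * c) + k).card =
      ((Finset.range r).filter fun i => F i m ≤ s + k).card := by
    intro k hk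
    have hFk := hF.toIsFilling.iterate h0 k
    have h := card_column_eq (r := 2 * r) (r' := 0) (lo := s + 2 * (r * c))
      (mid := s + 2 * (r * c) + k) (mid' := s + 2 * (r * c)) (hi := s + 2 * (r * c) + k)
      hFk hF2 (fun m v => by
        have h2 : (gromotion (rectDiagram (2 * r) c))^[r * c + r * c] F =
            (gromotion (rectDiagram (2 * r) c))^[2 * (r * c) - k]
              ((gromotion (rectDiagram (2 * r) c))^[k] F) := by
          rw [← Function.iterate_add_apply]
          congr 1
          omega
        rw [h2, hFk.hasDecFamily_iterate_iff h0 (by omega) (by omega)])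
      (by omega) (by omega) le_rfl (by omega)
      (fun i hi _ j hj => by have := (hFk.mem_Ioc hi hj).2; omega)
      (fun i hi hi' => absurd hi (not_lt.2 hi')) (by omega) le_rfl (by omega) (by omega)
      (fun i _ hi => absurd hi (Nat.not_lt_zero _))
      (fun i hi _ j hj => by have := (hF2.mem_Ioc hi hj).1; omega) hm
    have hm' : c - 1 - m < c := by omega
    have h1 := hF.card_column (hi := s + 2 * (r * c)) hr hc hk (by omega) le_rfl hm'
    have h2 := upperLength_add_card r c s F k (c - 1 - m)
    have hmm : c - 1 - (c - 1 - m) = m := by omega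
    rw [hmm] at h2
    have h3 : ((Finset.range r).filter fun i => F (r + i) (c - 1 - m) ≤ s + 2 * (r * c)).card =
        r := by
      rw [Finset.filter_true_of_mem, Finset.card_range]
      intro i hi
      rw [Finset.mem_range] at hi
      have := (hF.mem_Ioc (i := r + i) (j := c - 1 - m) (by omega) hm').2
      omega
    have h4 := Finset.card_filter_add_card_filter_not (s := Finset.range (2 * r))
      fun i => (gromotion (rectDiagram (2 * r) c))^[k] F i (c - 1 - m) ≤ s + 2 * (r * c)
    rw [Finset.card_range, h1, h3] at h4
    have h5 : ((Finset.range (2 * r)).filter fun i =>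
        (gromotion (rectDiagram (2 * r) c))^[r * c + r * c] F i m ≤ s + 2 * (r * c) + k).card =
        ((Finset.range (2 * r)).filter fun i =>
          ¬(gromotion (rectDiagram (2 * r) c))^[k] F i (c - 1 - m) ≤ s + 2 * (r * c)).card := by
      refine Eq.trans ?_ (h.symm.trans ?_)
      · congr 1
        refine Finset.filter_congr fun i hi => ?_
        rw [Finset.mem_range] at hi
        simp only [Nat.not_lt_zero, if_false]
        have := (hF2.mem_Ioc hi hm).1
        exact ⟨fun h => ⟨by omega, h⟩, fun h => h.2⟩
      · congr 1
        refine Finset.filter_congr fun i hi => ?_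
        rw [Finset.mem_range] at hi
        rw [if_pos hi, not_le]
        have := (hFk.mem_Ioc hi hm').2
        exact ⟨fun h => h.1, fun h => ⟨h, by omega⟩⟩
    omega
  have htop := hF.top a ha m hm
  have hmem := (hF.mem_Ioc (i := a) (by omega) hm).1
  have hg : ∀ i j, i < j → j < r → F i m < F j m := fun i j hij hj =>
    hF.toIsFilling.col_lt hm _ _ hij (by omega)
  have h1 := key (F a m - s) (by omega)
  rw [show s + (F a m - s) = F a m by omega,
    card_filter_le_apply (g := fun i => F i m) hg ha] at h1
  have h2 := key (F a m - s - 1) (by omega)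
  rw [show s + (F a m - s - 1) = F a m - 1 by omega,
    card_filter_le_apply_sub_one (g := fun i => F i m) hg ha (by omega)] at h2
  have h3 := le_iff_lt_card_filter (x := s + 2 * (r * c) + (F a m - s)) (a := a)
    (hF2.col_lt hm) (by omega)
  have h4 := le_iff_lt_card_filter (x := s + 2 * (r * c) + (F a m - s - 1)) (a := a)
    (hF2.col_lt hm) (by omega)
  rw [h1] at h3
  rw [h2] at h4
  omega

theorem iterate_apply_bot (hF : IsStackedFilling r c s F) (hr : 1 ≤ r) (hc : 1 ≤ c) {a m : ℕ}
    (ha : a < r) (hm : m < c) :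
    (gromotion (rectDiagram (2 * r) c))^[r * c] F (r + a) m = F a m + 2 * (r * c) := by
  rw [← (hF.iterate hr hc).iterate_apply_top hr hc ha hm, ← Function.iterate_add_apply,
    hF.iterate_iterate_apply hr hc ha hm]

/-- The label that slides from the lower to the upper half of the rectangle in each of the first
`r * c` gromotions of a stacked filling. -/
theorem entriesSlidingInto_iterate (hF : IsStackedFilling r c s F) (hr : 1 ≤ r) (hc : 1 ≤ c)
    {k a b : ℕ} (ha : a < r) (hb : b < c) (hk : F a b = s + k + 1) :
    entriesSlidingInto (rectDiagram (2 * r) c) ((gromotion (rectDiagram (2 * r) c))^[k] F) r =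
      {F (r + a) (c - 1 - b)} := by
  have h0 : (0, 0) ∈ rectDiagram (2 * r) c := zero_mem hr hc
  have e : 2 * r * c = 2 * (r * c) := by ring
  have htop := hF.top a ha b hb
  have hm : c - 1 - b < c := by omega
  have hmm : c - 1 - (c - 1 - b) = b := by omega
  have hg : ∀ i j, i < j → j < r → F i b < F j b := fun i j hij hj =>
    hF.toIsFilling.col_lt hb _ _ hij (by omega)
  have hFk := hF.toIsFilling.iterate h0 k
  have h1 := hF.iterate_apply (k := k) hr hc (by omega) ha hm
  have h2 := hF.iterate_apply (k := k + 1) hr hc (by omega) ha hm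
  have h3 := upperLength_add_card r c s F k (c - 1 - b)
  have h4 := upperLength_add_card r c s F (k + 1) (c - 1 - b)
  rw [hmm] at h3 h4
  rw [show s + k = F a b - 1 by omega,
    card_filter_le_apply_sub_one (g := fun i => F i b) hg ha (by omega)] at h3
  rw [show s + (k + 1) = F a b by omega, card_filter_le_apply (g := fun i => F i b) hg ha] at h4
  rw [show upperLength r c s F k (c - 1 - b) + a = r by omega] at h1
  rw [show upperLength r c s F (k + 1) (c - 1 - b) + a = r - 1 by omega,
    Function.iterate_succ_apply'] at h2
  have hx := (hF.mem_Ioc (i := r + a) (by omega) hm).2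
  set T := (gromotion (rectDiagram (2 * r) c))^[k] F with hT
  set m := c - 1 - b with hmdef
  obtain ⟨t, htlt, ht, ht'⟩ : ∃ t < (rectDiagram (2 * r) c).card,
      hole (rectDiagram (2 * r) c) T t = (r - 1, m) ∧
      hole (rectDiagram (2 * r) c) T (t + 1) = (r, m) := by
    rw [gromotion] at h2
    split_ifs at h2 with h5 h6
    · rw [card_rectDiagram, hFk.apply_zero h0] at h2
      omega
    · obtain ⟨t, htlt, ht⟩ := h5
      refine ⟨t, htlt, ht, ?_⟩
      rw [hole_succ, ht]
      have h7 := hole_mem (T := T) h0 (t + 1)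
      rw [hole_succ, ht] at h7
      exact hFk.bij.injOn h7 (show (r, m) ∈ {p | p ∈ rectDiagram (2 * r) c} from
        mem_rectDiagram.2 ⟨by dsimp only; omega, hm⟩) (h2.trans h1.symm)
    · have := hFk.col_lt hm (r - 1) r (by omega) (by omega)
      omega
  rw [entriesSlidingInto]
  refine Finset.eq_singleton_iff_unique_mem.2 ⟨?_, fun x hx => ?_⟩
  · refine Finset.mem_image.2 ⟨t, ?_, ?_⟩
    · rw [Finset.mem_filter, Finset.mem_range, ht, ht']
      exact ⟨htlt, by dsimp only; omega, rfl⟩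
    · rw [ht']
      exact h1
  · obtain ⟨t', ht1, rfl⟩ := Finset.mem_image.1 hx
    rw [Finset.mem_filter] at ht1
    -- The row of the empty cell never decreases.
    have htt : t' = t := by
      rcases lt_trichotomy t' t with h | h | h
      · have h8 := (hole_mono (T := T) h0 (Nat.succ_le_of_lt h)).1
        rw [ht] at h8
        dsimp only [Nat.succ_eq_add_one] at h8
        omega
      · exact h
      · have h8 := (hole_mono (T := T) h0 (Nat.succ_le_of_lt h)).1
        rw [Nat.succ_eq_add_one, ht'] at h8
        dsimp only at h8
        omega
    rw [htt, ht']
    exact h1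

end IsStackedFilling

/-! ### The promotion permutation of a stacked tableau -/

theorem RectSYT.isFilling {R C : ℕ} (T : RectSYT R C) : IsFilling R C 0 T.entry := by
  have hb := T.bijOn'
  rw [card_rectDiagram] at hb
  have hcells : ((rectDiagram R C).cells : Set (ℕ × ℕ)) = {p | p ∈ rectDiagram R C} := by
    ext p
    rw [Finset.mem_coe, YoungDiagram.mem_cells]
    rfl
  rw [hcells] at hb
  refine ⟨fun p q hpq hne hq => ?_, ?_⟩
  · rcases Nat.lt_or_ge p.1 q.1 with h | h
    · have h1 : (q.1, p.2) ∈ rectDiagram R C := 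
      mem_rectDiagram_of_le (show ((q.1, p.2) : ℕ × ℕ) ≤ q from ⟨le_rfl, hpq.2⟩) hq
      refine (T.col_strict' h h1).trans_le ?_
      rcases hpq.2.eq_or_lt with h2 | h2
      · rw [h2]
      · exact T.row_weak' h2 hq
    · have h1 : p.1 = q.1 := le_antisymm hpq.1 h
      have h2 : p.2 < q.2 := lt_of_le_of_ne hpq.2 fun e => hne (Prod.ext h1 e)
      have h3 : T.entry p.1 p.2 ≤ T.entry q.1 q.2 := by
        rw [h1]
        exact T.row_weak' h2 hq
      exact lt_of_le_of_ne h3 fun e => hne (hb.injOn (mem_rectDiagram_of_le hpq hq) hq e)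
  · rw [zero_add]
    exact hb

theorem RectSYT.ext {R C : ℕ} {T T' : RectSYT R C}
    (h : ∀ i < R, ∀ j < C, T.entry i j = T'.entry i j) : T = T' := by
  have h1 : T.toSemistandardYoungTableau = T'.toSemistandardYoungTableau := by
    refine SemistandardYoungTableau.ext fun i j => ?_
    by_cases hij : (i, j) ∈ rectDiagram R C
    · exact h i (mem_rectDiagram.1 hij).1 j (mem_rectDiagram.1 hij).2
    · exact (T.zeros' hij).trans (T'.zeros' hij).symm
  cases T
  cases T'
  cases h1
  rfl

theorem isStackedFilling_stack {r c : ℕ} (P Q : RectSYT r c) :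
    IsStackedFilling r c 0 (stack P Q).entry := by
  refine ⟨(stack P Q).isFilling, fun i hi j hj => ?_, fun i hi j hj => ?_⟩
  · change stackEntry P Q i j ≤ _
    rw [stackEntry_top _ _ hi, zero_add]
    exact (P.entry_mem hi hj).2
  · change _ < stackEntry P Q (r + i) j
    rw [stackEntry_bot _ _ (by omega) (by omega) hj, zero_add, Nat.add_sub_cancel_left]
    have := Q.entry_mem hi hj
    omega

section Prom

variable {r c : ℕ} {S : RectSYT (2 * r) c}

theorem prom_of_entry_top (hF : IsStackedFilling r c 0 S.entry) (hr : 1 ≤ r) (hc : 1 ≤ c)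
    {a b : ℕ} (ha : a < r) (hb : b < c) {k : Fin (2 * r * c)} (hk : S.entry a b = k + 1) :
    (prom S r k : ℕ) + 1 = S.entry (r + a) (c - 1 - b) := by
  have h := hF.entriesSlidingInto_iterate hr hc ha hb (k := k) (by omega)
  have hm := hF.mem_Ioc (i := r + a) (j := c - 1 - b) (by omega) (by omega)
  simp only [prom]
  rw [h, Finset.sup_singleton, id, Nat.mod_eq_of_lt (by omega)]
  omega

theorem prom_of_entry_bot (hF : IsStackedFilling r c 0 S.entry) (hr : 1 ≤ r) (hc : 1 ≤ c)
    {a b : ℕ} (ha : a < r) (hb : b < c) {k : Fin (2 * r * c)} (hk : S.entry (r + a) b = k + 1) :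
    (prom S r k : ℕ) + 1 = S.entry a (c - 1 - b) := by
  have e : 2 * r * c = 2 * (r * c) := by ring
  have hbot := hF.bot a ha b hb
  have hm := hF.mem_Ioc (i := a) (j := c - 1 - b) (by omega) (by omega)
  have htop := hF.top a ha (c - 1 - b) (by omega)
  have h := (hF.iterate hr hc).entriesSlidingInto_iterate hr hc ha hb (k := k - r * c)
    (by rw [hF.iterate_apply_top hr hc ha hb]; omega)
  rw [← Function.iterate_add_apply, hF.iterate_apply_bot hr hc ha (by omega),
    Nat.sub_add_cancel (by omega)] at h
  simp only [prom]
  rw [h, Finset.sup_singleton, id,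
    show S.entry a (c - 1 - b) + 2 * (r * c) - 1 = S.entry a (c - 1 - b) - 1 + 2 * r * c by omega,
    Nat.add_mod_right, Nat.mod_eq_of_lt (by omega)]
  omega

theorem exists_entry_eq (hF : IsStackedFilling r c 0 S.entry) (k : Fin (2 * r * c)) :
    (∃ a < r, ∃ b < c, S.entry a b = k + 1 ∧ (k : ℕ) < r * c) ∨
      ∃ a < r, ∃ b < c, S.entry (r + a) b = k + 1 ∧ r * c ≤ (k : ℕ) := by
  obtain ⟨⟨i, j⟩, hq, hqk⟩ := hF.bij.surjOn (show (k : ℕ) + 1 ∈ Set.Ioc 0 (0 + 2 * r * c) from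
    ⟨Nat.succ_pos _, by have := k.2; omega⟩)
  rw [Set.mem_ofPred_eq, mem_rectDiagram] at hq
  dsimp only at hq hqk
  rcases Nat.lt_or_ge i r with h | h
  · have := hF.top i h j hq.2
    exact Or.inl ⟨i, h, j, hq.2, hqk, by omega⟩
  · obtain ⟨i, rfl⟩ := Nat.exists_eq_add_of_le h
    have := hF.bot i (by omega) j hq.2
    exact Or.inr ⟨i, by omega, j, hq.2, hqk, by omega⟩

theorem prom_involutive (hF : IsStackedFilling r c 0 S.entry) (hr : 1 ≤ r) (hc : 1 ≤ c) :
    Function.Involutive (prom S r) := by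
  intro k
  rw [Fin.ext_iff]
  rcases exists_entry_eq hF k with ⟨a, ha, b, hb, hk, -⟩ | ⟨a, ha, b, hb, hk, -⟩
  · have h1 := prom_of_entry_top hF hr hc ha hb hk
    have h2 := prom_of_entry_bot hF hr hc ha (by omega) h1.symm
    rw [show c - 1 - (c - 1 - b) = b by omega] at h2
    omega
  · have h1 := prom_of_entry_bot hF hr hc ha hb hk
    have h2 := prom_of_entry_top hF hr hc ha (by omega) h1.symm
    rw [show c - 1 - (c - 1 - b) = b by omega] at h2
    omega

theorem prom_lt_iff (hF : IsStackedFilling r c 0 S.entry) (hr : 1 ≤ r) (hc : 1 ≤ c)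
    (k : Fin (2 * r * c)) : (prom S r k : ℕ) < r * c ↔ r * c ≤ (k : ℕ) := by
  rcases exists_entry_eq hF k with ⟨a, ha, b, hb, hk, hk'⟩ | ⟨a, ha, b, hb, hk, hk'⟩
  · have h1 := prom_of_entry_top hF hr hc ha hb hk
    have h2 := hF.bot a ha (c - 1 - b) (by omega)
    omega
  · have h1 := prom_of_entry_bot hF hr hc ha hb hk
    have h2 := hF.top a ha (c - 1 - b) (by omega)
    omega

end Prom

/-! ### Ranks of chains -/

/-- `A` is a chain of the relation `rel`, listed increasingly. -/
def IsRelChain {N : ℕ} (rel : Fin N → Fin N → Prop) (A : Finset (Fin N)) : Prop :=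
  ∀ u ∈ A, ∀ v ∈ A, u < v → rel u v

/-- The largest size of a chain of `rel` with largest element `x`. -/
noncomputable def chainRank {N : ℕ} (rel : Fin N → Fin N → Prop) (x : Fin N) : ℕ :=
  open Classical in
  (Finset.univ.filter fun A : Finset (Fin N) => x ∈ A ∧ (∀ u ∈ A, u ≤ x) ∧
    IsRelChain rel A).sup Finset.card

section Chain

variable {N : ℕ} {rel : Fin N → Fin N → Prop}

theorem card_le_chainRank {x : Fin N} {A : Finset (Fin N)} (hx : x ∈ A) (hle : ∀ u ∈ A, u ≤ x)
    (hA : IsRelChain rel A) : A.card ≤ chainRank rel x := by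
  classical
  exact Finset.le_sup (f := Finset.card) (Finset.mem_filter.2 ⟨Finset.mem_univ _, hx, hle, hA⟩)

theorem exists_card_eq_chainRank (rel : Fin N → Fin N → Prop) (x : Fin N) :
    ∃ A : Finset (Fin N), x ∈ A ∧ (∀ u ∈ A, u ≤ x) ∧ IsRelChain rel A ∧
      A.card = chainRank rel x := by
  classical
  obtain ⟨A, hA, h⟩ := Finset.exists_mem_eq_sup
    (Finset.univ.filter fun A : Finset (Fin N) => x ∈ A ∧ (∀ u ∈ A, u ≤ x) ∧ IsRelChain rel A)
    ⟨{x}, Finset.mem_filter.2 ⟨Finset.mem_univ _, Finset.mem_singleton_self x,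
      fun u hu => (Finset.mem_singleton.1 hu).le, fun u hu v hv huv => absurd huv (by
        rw [Finset.mem_singleton.1 hu, Finset.mem_singleton.1 hv]; exact lt_irrefl x)⟩⟩ Finset.card
  obtain ⟨-, h1, h2, h3⟩ := Finset.mem_filter.1 hA
  exact ⟨A, h1, h2, h3, by rw [chainRank, ← h]⟩

theorem chainRank_pos (rel : Fin N → Fin N → Prop) (x : Fin N) : 1 ≤ chainRank rel x := by
  obtain ⟨A, hx, -, -, h⟩ := exists_card_eq_chainRank rel x
  rw [← h]
  exact Finset.card_pos.2 ⟨x, hx⟩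

theorem chainRank_lt_of_rel (htrans : ∀ u v w, rel u v → rel v w → rel u w)
    (hlt : ∀ u v, rel u v → u < v) {x y : Fin N} (hxy : rel x y) :
    chainRank rel x < chainRank rel y := by
  classical
  obtain ⟨A, hx, hle, hA, h⟩ := exists_card_eq_chainRank rel x
  have hy : y ∉ A := fun hy => absurd (hle y hy) (not_le.2 (hlt x y hxy))
  have hxy' := hlt x y hxy
  rw [← h, ← Nat.succ_le_iff, Nat.succ_eq_add_one, ← Finset.card_insert_of_notMem hy]
  refine card_le_chainRank (Finset.mem_insert_self _ _) (fun u hu => ?_) fun u hu v hv huv => ?_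
  · rcases Finset.mem_insert.1 hu with rfl | hu
    · exact le_rfl
    · exact (hle u hu).trans hxy'.le
  · rcases Finset.mem_insert.1 hu with hu' | hu' <;> rcases Finset.mem_insert.1 hv with hv' | hv'
    · exact absurd huv (by rw [hu', hv']; exact lt_irrefl _)
    · exact absurd ((hle v hv').trans_lt hxy') (by rw [← hu']; exact huv.not_gt)
    · rw [hv']
      rcases (hle u hu').eq_or_lt with rfl | h1
      · exact hxy
      · exact htrans _ _ _ (hA u hu' x hx h1) hxy
    · exact hA u hu' v hv' huv

theorem IsRelChain.card_le {K : ℕ} {f : Fin N → ℕ} (hf : ∀ u, f u < K)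
    (hrel : ∀ u v, rel u v → f u ≠ f v) {A : Finset (Fin N)} (hA : IsRelChain rel A) :
    A.card ≤ K := by
  rw [← Finset.card_range K]
  refine Finset.card_le_card_of_injOn f (fun u _ => Finset.mem_coe.2 (Finset.mem_range.2 (hf u)))
    fun u hu v hv e => ?_
  rcases lt_trichotomy u v with h | h | h
  · exact absurd e (hrel u v (hA u hu v hv h))
  · exact h
  · exact absurd e.symm (hrel v u (hA v hv u hu h))

theorem isRelChain_image (hlt : ∀ u v, rel u v → u < v) {K : ℕ} {g : ℕ → Fin N}
    (hg : ∀ i j, i < j → j < K → rel (g i) (g j)) {I : Finset ℕ} (hI : ∀ i ∈ I, i < K) :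
    IsRelChain rel (I.image g) ∧ (I.image g).card = I.card := by
  constructor
  · intro u hu v hv huv
    obtain ⟨i, hi, rfl⟩ := Finset.mem_image.1 hu
    obtain ⟨j, hj, rfl⟩ := Finset.mem_image.1 hv
    rcases lt_trichotomy i j with h | rfl | h
    · exact hg i j h (hI j hj)
    · exact absurd huv (lt_irrefl _)
    · exact absurd huv (hlt _ _ (hg j i h (hI i hi))).not_gt
  · refine Finset.card_image_of_injOn fun i hi j hj e => ?_
    rcases lt_trichotomy i j with h | h | h
    · exact absurd e (hlt _ _ (hg i j h (hI j hj))).ne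
    · exact h
    · exact absurd e.symm (hlt _ _ (hg j i h (hI i hi))).ne

/-- If no chain contains two elements with the same index `f u < K`, and `x` lies on a chain that
has elements of all indices in increasing order, then the index of `x` determines its rank: a longer
chain below `x` could be continued to a chain with more than `K` elements. -/
theorem chainRank_eq (htrans : ∀ u v w, rel u v → rel v w → rel u w)
    (hlt : ∀ u v, rel u v → u < v) {K : ℕ} {f : Fin N → ℕ} (hf : ∀ u, f u < K)
    (hrel : ∀ u v, rel u v → f u ≠ f v) {x : Fin N} {g : ℕ → Fin N}
    (hg : ∀ i j, i < j → j < K → rel (g i) (g j)) (hgx : g (f x) = x) :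
    chainRank rel x = f x + 1 := by
  classical
  have hfx := hf x
  refine le_antisymm ?_ ?_
  · obtain ⟨A, hx, hle, hA, h⟩ := exists_card_eq_chainRank rel x
    obtain ⟨hB, hBc⟩ := isRelChain_image hlt hg (I := Finset.Ioo (f x) K)
      fun i hi => (Finset.mem_Ioo.1 hi).2
    set B := (Finset.Ioo (f x) K).image g with hBdef
    have hxB : ∀ v ∈ B, rel x v := by
      intro v hv
      obtain ⟨i, hi, rfl⟩ := Finset.mem_image.1 hv
      rw [Finset.mem_Ioo] at hi
      have := hg (f x) i hi.1 hi.2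
      rwa [hgx] at this
    have hAB : ∀ u ∈ A, ∀ v ∈ B, rel u v := by
      intro u hu v hv
      rcases (hle u hu).eq_or_lt with rfl | h1
      · exact hxB v hv
      · exact htrans _ _ _ (hA u hu x hx h1) (hxB v hv)
    have hdisj : Disjoint A B := Finset.disjoint_left.2 fun u hu hu' =>
      lt_irrefl _ (hlt _ _ (hAB u hu u hu'))
    have hchain : IsRelChain rel (A ∪ B) := by
      intro u hu v hv huv
      rcases Finset.mem_union.1 hu with hu | hu <;> rcases Finset.mem_union.1 hv with hv | hv
      · exact hA u hu v hv huv
      · exact hAB u hu v hv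
      · exact absurd huv (hlt _ _ (hAB v hv u hu)).not_gt
      · exact hB u hu v hv huv
    have h1 := hchain.card_le hf hrel
    rw [Finset.card_union_of_disjoint hdisj, hBc, Nat.card_Ioo, h] at h1
    omega
  · obtain ⟨hB, hBc⟩ := isRelChain_image hlt hg (I := Finset.range (f x + 1))
      fun i hi => by rw [Finset.mem_range] at hi; omega
    rw [Finset.card_range] at hBc
    rw [← hBc]
    refine card_le_chainRank (Finset.mem_image.2 ⟨f x, by simp, hgx⟩) (fun u hu => ?_) hB
    obtain ⟨i, hi, rfl⟩ := Finset.mem_image.1 hu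
    rw [Finset.mem_range] at hi
    rcases (Nat.le_of_lt_succ hi).eq_or_lt with rfl | h
    · rw [hgx]
    · have := hlt _ _ (hg i (f x) h hfx)
      rw [hgx] at this
      exact this.le

end Chain

/-! ### Crossings and nestings -/

section Matching

variable {N : ℕ}

/-- The blocks of `x` and `y` cross, for openers `x < y` among the first `n` elements. -/
def CrossRel (ρ : Equiv.Perm (Fin N)) (n : ℕ) (x y : Fin N) : Prop :=
  x < y ∧ ρ x < ρ y ∧ (y : ℕ) < n

/-- The blocks of `x` and `y` are nested, for openers `x < y` among the first `n` elements. -/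
def NestRel (ρ : Equiv.Perm (Fin N)) (n : ℕ) (x y : Fin N) : Prop :=
  x < y ∧ ρ y < ρ x ∧ (y : ℕ) < n

theorem CrossRel.trans {ρ : Equiv.Perm (Fin N)} {n : ℕ} (u v w : Fin N) (h : CrossRel ρ n u v)
    (h' : CrossRel ρ n v w) : CrossRel ρ n u w :=
  ⟨h.1.trans h'.1, h.2.1.trans h'.2.1, h'.2.2⟩

theorem NestRel.trans {ρ : Equiv.Perm (Fin N)} {n : ℕ} (u v w : Fin N) (h : NestRel ρ n u v)
    (h' : NestRel ρ n v w) : NestRel ρ n u w :=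
  ⟨h.1.trans h'.1, h'.2.1.trans h.2.1, h'.2.2⟩

theorem hasCrossing_iff {ρ : Equiv.Perm (Fin N)} {n k : ℕ}
    (hρ : ∀ x, (ρ x : ℕ) < n ↔ n ≤ (x : ℕ)) :
    HasCrossing ρ k ↔
      ∃ A : Finset (Fin N), (∀ x ∈ A, (x : ℕ) < n) ∧ IsRelChain (CrossRel ρ n) A ∧ A.card = k := by
  constructor
  · rintro ⟨i, j, hij, hi, hj, hlt⟩
    have hin : ∀ t, (i t : ℕ) < n := fun t => by
      by_contra h
      have h1 := (hρ (i t)).2 (not_lt.1 h)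
      have h2 := hlt t t
      rw [hij] at h1
      rw [Fin.lt_def] at h2
      omega
    refine ⟨Finset.univ.image i, fun x hx => ?_, fun u hu v hv huv => ?_, ?_⟩
    · obtain ⟨t, -, rfl⟩ := Finset.mem_image.1 hx
      exact hin t
    · obtain ⟨t, -, rfl⟩ := Finset.mem_image.1 hu
      obtain ⟨t', -, rfl⟩ := Finset.mem_image.1 hv
      refine ⟨huv, ?_, hin t'⟩
      rw [hij, hij]
      exact hj (hi.lt_iff_lt.1 huv)
    · rw [Finset.card_image_of_injective _ hi.injective, Finset.card_univ, Fintype.card_fin]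
  · rintro ⟨A, hAn, hA, rfl⟩
    refine ⟨A.orderEmbOfFin rfl, fun t => ρ (A.orderEmbOfFin rfl t), fun _ => rfl,
      (A.orderEmbOfFin rfl).strictMono, fun s t hst => ?_, fun s t => ?_⟩
    · exact (hA _ (Finset.orderEmbOfFin_mem _ _ s) _ (Finset.orderEmbOfFin_mem _ _ t)
        ((A.orderEmbOfFin rfl).strictMono hst)).2.1
    · have h1 := hAn _ (Finset.orderEmbOfFin_mem A rfl s)
      have h2 := hAn _ (Finset.orderEmbOfFin_mem A rfl t)
      have h3 := (hρ (A.orderEmbOfFin rfl t)).not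
      rw [Fin.lt_def]
      dsimp only
      omega

theorem hasNesting_iff {ρ : Equiv.Perm (Fin N)} {n k : ℕ}
    (hρ : ∀ x, (ρ x : ℕ) < n ↔ n ≤ (x : ℕ)) :
    HasNesting ρ k ↔
      ∃ A : Finset (Fin N), (∀ x ∈ A, (x : ℕ) < n) ∧ IsRelChain (NestRel ρ n) A ∧ A.card = k := by
  constructor
  · rintro ⟨i, j, hij, hi, hj, hlt⟩
    have hin : ∀ t, (i t : ℕ) < n := fun t => by
      by_contra h
      have h1 := (hρ (i t)).2 (not_lt.1 h)
      have h2 := hlt t t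
      rw [hij] at h1
      rw [Fin.lt_def] at h2
      omega
    refine ⟨Finset.univ.image i, fun x hx => ?_, fun u hu v hv huv => ?_, ?_⟩
    · obtain ⟨t, -, rfl⟩ := Finset.mem_image.1 hx
      exact hin t
    · obtain ⟨t, -, rfl⟩ := Finset.mem_image.1 hu
      obtain ⟨t', -, rfl⟩ := Finset.mem_image.1 hv
      refine ⟨huv, ?_, hin t'⟩
      rw [hij, hij]
      exact hj (hi.lt_iff_lt.1 huv)
    · rw [Finset.card_image_of_injective _ hi.injective, Finset.card_univ, Fintype.card_fin]
  · rintro ⟨A, hAn, hA, rfl⟩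
    refine ⟨A.orderEmbOfFin rfl, fun t => ρ (A.orderEmbOfFin rfl t), fun _ => rfl,
      (A.orderEmbOfFin rfl).strictMono, fun s t hst => ?_, fun s t => ?_⟩
    · exact (hA _ (Finset.orderEmbOfFin_mem _ _ s) _ (Finset.orderEmbOfFin_mem _ _ t)
        ((A.orderEmbOfFin rfl).strictMono hst)).2.1
    · have h1 := hAn _ (Finset.orderEmbOfFin_mem A rfl s)
      have h2 := hAn _ (Finset.orderEmbOfFin_mem A rfl t)
      have h3 := (hρ (A.orderEmbOfFin rfl t)).not
      rw [Fin.lt_def]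
      dsimp only
      omega

theorem bddAbove_hasCrossing (ρ : Equiv.Perm (Fin N)) : BddAbove {k | HasCrossing ρ k} := by
  refine ⟨N, fun k hk => ?_⟩
  obtain ⟨i, -, -, hi, -⟩ := hk
  simpa using Fintype.card_le_of_injective i hi.injective

theorem bddAbove_hasNesting (ρ : Equiv.Perm (Fin N)) : BddAbove {k | HasNesting ρ k} := by
  refine ⟨N, fun k hk => ?_⟩
  obtain ⟨i, -, -, hi, -⟩ := hk
  simpa using Fintype.card_le_of_injective i hi.injective

/-- The rank of an opener is at most the size of the largest chains of openers. -/
theorem chainRank_le {rel : Fin N → Fin N → Prop} {n K : ℕ}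
    (h : ∀ A : Finset (Fin N), (∀ x ∈ A, (x : ℕ) < n) → IsRelChain rel A → A.card ≤ K) {x : Fin N}
    (hx : (x : ℕ) < n) : chainRank rel x ≤ K := by
  obtain ⟨A, -, hle, hA, hc⟩ := exists_card_eq_chainRank rel x
  rw [← hc]
  exact h A (fun u hu => lt_of_le_of_lt (hle u hu) hx) hA

end Matching

section StackedMatching

variable {r c : ℕ} {S : RectSYT (2 * r) c} {ρ : Equiv.Perm (Fin (2 * r * c))}

/-- In the matching of a stacked tableau, openers in the same column of the upper half cross, openers
in the same row nest, and the position of an opener in the tableau is given by its ranks. -/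
theorem matching_stacked (hF : IsStackedFilling r c 0 S.entry) (hr : 1 ≤ r) (hc : 1 ≤ c)
    (hρ : ∀ k, ρ k = prom S r k) :
    (∀ a < r, ∀ b < c, ∀ x : Fin (2 * r * c), S.entry a b = x + 1 →
      chainRank (CrossRel ρ (r * c)) x = a + 1 ∧ chainRank (NestRel ρ (r * c)) x = b + 1) ∧
    crossingNumber ρ = r ∧ nestingNumber ρ = c := by
  classical
  have e : 2 * r * c = 2 * (r * c) := by ring
  have hpos : 0 < r * c := Nat.mul_pos hr hc
  -- The opener with a given cell, and the cell of an opener.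
  have hlab : ∀ i j, ∃ x : Fin (2 * r * c), i < r → j < c → S.entry i j = x + 1 := by
    intro i j
    by_cases h : i < r ∧ j < c
    · have := hF.mem_Ioc (i := i) (j := j) (by omega) h.2
      exact ⟨⟨S.entry i j - 1, by omega⟩, fun _ _ => by dsimp only; omega⟩
    · exact ⟨⟨0, by omega⟩, fun h1 h2 => absurd ⟨h1, h2⟩ h⟩
  choose lab hlab using hlab
  have hcell : ∀ x : Fin (2 * r * c), ∃ q : ℕ × ℕ, q.1 < r ∧ q.2 < c ∧
      ((x : ℕ) < r * c → S.entry q.1 q.2 = x + 1) := by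
    intro x
    rcases exists_entry_eq hF x with ⟨a, ha, b, hb, hx, -⟩ | ⟨-, -, -, -, -, hx⟩
    · exact ⟨(a, b), ha, hb, fun _ => hx⟩
    · exact ⟨(0, 0), hr, hc, fun h => absurd h (not_lt.2 hx)⟩
  choose cell hcell1 hcell2 hcell using hcell
  have hlabn : ∀ a < r, ∀ b < c, (lab a b : ℕ) < r * c := fun a ha b hb => by
    have := hF.top a ha b hb
    have := hlab a b ha hb
    omega
  have hlabρ : ∀ a < r, ∀ b < c, (ρ (lab a b) : ℕ) + 1 = S.entry (r + a) (c - 1 - b) :=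
    fun a ha b hb => by
      rw [hρ]
      exact prom_of_entry_top hF hr hc ha hb (hlab a b ha hb)
  have hentry : ∀ i j i' j', i ≤ i' → j ≤ j' → (i, j) ≠ (i', j') → i' < 2 * r → j' < c →
      S.entry i j < S.entry i' j' := fun i j i' j' hi hj hne hi' hj' =>
    hF.lt (i, j) (i', j') ⟨hi, hj⟩ hne (mem_rectDiagram.2 ⟨hi', hj'⟩)
  have hcross : ∀ i i' b, i < i' → i' < r → b < c →
      CrossRel ρ (r * c) (lab i b) (lab i' b) := by
    intro i i' b hi hi' hb
    have h1 := hentry i b i' b hi.le le_rfl (fun e => hi.ne (congrArg Prod.fst e)) (by omega) hb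
    have h2 := hentry (r + i) (c - 1 - b) (r + i') (c - 1 - b) (by omega) le_rfl
      (fun e => hi.ne (Nat.add_left_cancel (congrArg Prod.fst e))) (by omega) (by omega)
    have h3 := hlab i b (by omega) hb
    have h4 := hlab i' b hi' hb
    have h5 := hlabρ i (by omega) b hb
    have h6 := hlabρ i' hi' b hb
    exact ⟨Fin.lt_def.2 (by omega), Fin.lt_def.2 (by omega), hlabn i' hi' b hb⟩
  have hnest : ∀ a j j', j < j' → a < r → j' < c →
      NestRel ρ (r * c) (lab a j) (lab a j') := by
    intro a j j' hj ha hj'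
    have h1 := hentry a j a j' le_rfl hj.le (fun e => hj.ne (congrArg Prod.snd e)) (by omega) hj'
    have h2 := hentry (r + a) (c - 1 - j') (r + a) (c - 1 - j) le_rfl (by omega)
      (fun e => by have := congrArg Prod.snd e; dsimp only at this; omega) (by omega) (by omega)
    have h3 := hlab a j ha (by omega)
    have h4 := hlab a j' ha hj'
    have h5 := hlabρ a ha j (by omega)
    have h6 := hlabρ a ha j' hj'
    exact ⟨Fin.lt_def.2 (by omega), Fin.lt_def.2 (by omega), hlabn a ha j' hj'⟩
  have hlabcell : ∀ x : Fin (2 * r * c), (x : ℕ) < r * c → lab (cell x).1 (cell x).2 = x :=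
    fun x hx => by
      have h1 := hcell x hx
      have h2 := hlab _ _ (hcell1 x) (hcell2 x)
      exact Fin.ext (by omega)
  have hcelllab : ∀ a < r, ∀ b < c, cell (lab a b) = (a, b) := fun a ha b hb => by
    have h1 := hlabcell _ (hlabn a ha b hb)
    have h2 := hlab _ _ (hcell1 (lab a b)) (hcell2 (lab a b))
    rw [h1, ← hlab a b ha hb] at h2
    have h3 := hcell1 (lab a b)
    exact hF.bij.injOn (mem_rectDiagram.2 ⟨by omega, hcell2 _⟩)
      (show (a, b) ∈ {p | p ∈ rectDiagram (2 * r) c} from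
        mem_rectDiagram.2 ⟨by dsimp only; omega, hb⟩) h2
  -- Crossing openers lie in different rows, nesting openers in different columns.
  have hrow : ∀ u v, CrossRel ρ (r * c) u v → (cell u).1 ≠ (cell v).1 := by
    intro u v huv heq
    have hv := huv.2.2
    have hu : (u : ℕ) < r * c := lt_trans huv.1 hv
    rcases lt_trichotomy (cell u).2 (cell v).2 with h | h | h
    · have := hnest (cell u).1 _ _ h (hcell1 u) (hcell2 v)
      rw [hlabcell u hu, heq, hlabcell v hv] at this
      exact lt_asymm huv.2.1 this.2.1
    · have := hlabcell u hu
      rw [heq, h, hlabcell v hv] at this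
      exact huv.1.ne' this
    · have := hnest (cell u).1 _ _ h (hcell1 u) (hcell2 u)
      rw [hlabcell u hu, heq, hlabcell v hv] at this
      exact lt_asymm huv.1 this.1
  have hcol : ∀ u v, NestRel ρ (r * c) u v → (cell u).2 ≠ (cell v).2 := by
    intro u v huv heq
    have hv := huv.2.2
    have hu : (u : ℕ) < r * c := lt_trans huv.1 hv
    rcases lt_trichotomy (cell u).1 (cell v).1 with h | h | h
    · have := hcross _ _ (cell u).2 h (hcell1 v) (hcell2 u)
      rw [hlabcell u hu, heq, hlabcell v hv] at this
      exact lt_asymm huv.2.1 this.2.1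
    · have := hlabcell u hu
      rw [heq, h, hlabcell v hv] at this
      exact huv.1.ne' this
    · have := hcross _ _ (cell u).2 h (hcell1 u) (hcell2 u)
      rw [hlabcell u hu, heq, hlabcell v hv] at this
      exact lt_asymm huv.1 this.1
  have hρlt : ∀ x, (ρ x : ℕ) < r * c ↔ r * c ≤ (x : ℕ) := fun x => by
    rw [hρ]
    exact prom_lt_iff hF hr hc x
  refine ⟨fun a ha b hb x hx => ?_, ?_, ?_⟩
  · have hxl : lab a b = x := Fin.ext (by have := hlab a b ha hb; omega)
    have hxc := hcelllab a ha b hb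
    rw [hxl] at hxc
    have h1 := chainRank_eq (rel := CrossRel ρ (r * c)) CrossRel.trans (fun _ _ h => h.1)
      (f := fun u => (cell u).1) hcell1 hrow (x := x) (g := fun i => lab i b)
      (fun i j hij hj => hcross i j b hij hj hb) (by rw [hxc]; exact hxl)
    have h2 := chainRank_eq (rel := NestRel ρ (r * c)) NestRel.trans (fun _ _ h => h.1)
      (f := fun u => (cell u).2) hcell2 hcol (x := x) (g := fun j => lab a j)
      (fun i j hij hj => hnest a i j hij ha hj) (by rw [hxc]; exact hxl)
    rw [hxc] at h1 h2
    exact ⟨h1, h2⟩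
  · refine IsGreatest.csSup_eq ⟨?_, fun k hk => ?_⟩
    · obtain ⟨h1, h2⟩ := isRelChain_image (rel := CrossRel ρ (r * c)) (fun _ _ h => h.1)
        (g := fun i => lab i 0) (K := r) (fun i j hij hj => hcross i j 0 hij hj hc)
        (I := Finset.range r) fun i hi => Finset.mem_range.1 hi
      refine (hasCrossing_iff hρlt).2 ⟨_, fun x hx => ?_, h1, h2.trans (Finset.card_range r)⟩
      obtain ⟨i, hi, rfl⟩ := Finset.mem_image.1 hx
      exact hlabn i (Finset.mem_range.1 hi) 0 hc
    · obtain ⟨A, -, hA, rfl⟩ := (hasCrossing_iff hρlt).1 hk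
      exact hA.card_le hcell1 hrow
  · refine IsGreatest.csSup_eq ⟨?_, fun k hk => ?_⟩
    · obtain ⟨h1, h2⟩ := isRelChain_image (rel := NestRel ρ (r * c)) (fun _ _ h => h.1)
        (g := fun j => lab 0 j) (K := c) (fun i j hij hj => hnest 0 i j hij hr hj)
        (I := Finset.range c) fun i hi => Finset.mem_range.1 hi
      refine (hasNesting_iff hρlt).2 ⟨_, fun x hx => ?_, h1, h2.trans (Finset.card_range c)⟩
      obtain ⟨i, hi, rfl⟩ := Finset.mem_image.1 hx
      exact hlabn 0 hr i (Finset.mem_range.1 hi)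
    · obtain ⟨A, -, hA, rfl⟩ := (hasNesting_iff hρlt).1 hk
      exact hA.card_le hcell2 hcol

/-- A stacked tableau is determined by its matching. -/
theorem eq_of_prom_eq {S' : RectSYT (2 * r) c} (hF : IsStackedFilling r c 0 S.entry)
    (hF' : IsStackedFilling r c 0 S'.entry) (hr : 1 ≤ r) (hc : 1 ≤ c)
    (h : ∀ k, prom S r k = prom S' r k) : S = S' := by
  set ρ := (prom_involutive hF hr hc).toPerm with hρ
  have h1 := (matching_stacked (ρ := ρ) hF hr hc fun k => rfl).1
  have h2 := (matching_stacked (ρ := ρ) hF' hr hc fun k => h k).1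
  have htop : ∀ a < r, ∀ b < c, S.entry a b = S'.entry a b := by
    intro a ha b hb
    have hm := hF.mem_Ioc (i := a) (j := b) (by omega) hb
    have hn := hF.top a ha b hb
    obtain ⟨x, hx⟩ : ∃ x : Fin (2 * r * c), S.entry a b = x + 1 :=
      ⟨⟨S.entry a b - 1, by omega⟩, by dsimp only; omega⟩
    rcases exists_entry_eq hF' x with ⟨a', ha', b', hb', hx', -⟩ | ⟨-, -, -, -, -, hx'⟩
    · have h3 := h1 a ha b hb x hx
      have h4 := h2 a' ha' b' hb' x hx'
      obtain rfl : a = a' := by omega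
      obtain rfl : b = b' := by omega
      rw [hx, hx']
    · omega
  refine RectSYT.ext fun i hi j hj => ?_
  rcases Nat.lt_or_ge i r with hir | hir
  · exact htop i hir j hj
  · obtain ⟨a, rfl⟩ := Nat.exists_eq_add_of_le hir
    have ha : a < r := by omega
    have hb : c - 1 - j < c := by omega
    have hm := hF.mem_Ioc (i := a) (j := c - 1 - j) (by omega) hb
    obtain ⟨x, hx⟩ : ∃ x : Fin (2 * r * c), S.entry a (c - 1 - j) = x + 1 :=
      ⟨⟨S.entry a (c - 1 - j) - 1, by omega⟩, by dsimp only; omega⟩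
    have h3 := prom_of_entry_top hF hr hc ha hb hx
    rw [htop a ha _ hb] at hx
    have h4 := prom_of_entry_top hF' hr hc ha hb hx
    rw [show c - 1 - (c - 1 - j) = j by omega] at h3 h4
    rw [← h3, ← h4, h]

end StackedMatching

/-- The standard tableau with given increasing entries in a rectangle; distinct entries between `1`
and the number of cells take each of these values. -/
def rectSYTOfEntries {R C : ℕ} (f : ℕ → ℕ → ℕ)
    (hrow : ∀ i < R, ∀ j j', j < j' → j' < C → f i j < f i j')
    (hcol : ∀ i i', i < i' → i' < R → ∀ j < C, f i j < f i' j)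
    (hmem : ∀ i < R, ∀ j < C, f i j ∈ Set.Icc 1 (R * C))
    (hinj : ∀ i < R, ∀ j < C, ∀ i' < R, ∀ j' < C, f i j = f i' j' → (i, j) = (i', j')) :
    RectSYT R C where
  entry i j := if i < R ∧ j < C then f i j else 0
  row_weak' := by
    intro i j1 j2 hj h
    obtain ⟨hi, hj2⟩ : i < R ∧ j2 < C := mem_rectDiagram.1 h
    rw [if_pos ⟨hi, hj.trans hj2⟩, if_pos ⟨hi, hj2⟩]
    exact (hrow i hi j1 j2 hj hj2).le
  col_strict' := by
    intro i1 i2 j hi h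
    obtain ⟨hi2, hj⟩ : i2 < R ∧ j < C := mem_rectDiagram.1 h
    rw [if_pos ⟨hi.trans hi2, hj⟩, if_pos ⟨hi2, hj⟩]
    exact hcol i1 i2 hi hi2 j hj
  zeros' := by
    intro i j h
    exact if_neg fun hh => h (mem_rectDiagram.2 hh)
  bijOn' := by
    have hmem' : ∀ p ∈ (rectDiagram R C).cells, p.1 < R ∧ p.2 < C := fun p hp => by
      rwa [YoungDiagram.mem_cells, mem_rectDiagram] at hp
    rw [card_rectDiagram]
    have hmaps : Set.MapsTo (fun p : ℕ × ℕ => if p.1 < R ∧ p.2 < C then f p.1 p.2 else 0)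
        ((rectDiagram R C).cells : Set (ℕ × ℕ)) (Finset.Icc 1 (R * C) : Finset ℕ) := by
      intro p hp
      have hp' := hmem' p hp
      dsimp only
      rw [if_pos hp', Finset.coe_Icc]
      exact hmem _ hp'.1 _ hp'.2
    have hinjOn : Set.InjOn (fun p : ℕ × ℕ => if p.1 < R ∧ p.2 < C then f p.1 p.2 else 0)
        ((rectDiagram R C).cells : Set (ℕ × ℕ)) := by
      intro p hp q hq e
      have hp' := hmem' p hp
      have hq' := hmem' q hq
      dsimp only at e
      rw [if_pos hp', if_pos hq'] at e
      exact hinj _ hp'.1 _ hp'.2 _ hq'.1 _ hq'.2 e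
    have hsurj := Finset.surjOn_of_injOn_of_card_le _ hmaps hinjOn (by
      rw [Nat.card_Icc, Nat.add_sub_cancel]
      exact (card_rectDiagram R C).ge)
    rw [Finset.coe_Icc] at hmaps hsurj
    exact ⟨hmaps, hinjOn, hsurj⟩

/-- Every matching with the given crossing and nesting numbers comes from a stacked tableau. As in the
theorem of Erdős and Szekeres, the openers are distinguished by their ranks for crossings and
nestings; since there are `r * c` openers, each pair of ranks occurs exactly once. -/
theorem exists_stack_of_matching {r c : ℕ} {ρ : Equiv.Perm (Fin (2 * r * c))}
    (hinv : ∀ a, ρ (ρ a) = a) (hρ : ∀ x, (ρ x : ℕ) < r * c ↔ r * c ≤ (x : ℕ))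
    (hcr : ∀ k, HasCrossing ρ k → k ≤ r) (hne : ∀ k, HasNesting ρ k → k ≤ c) (hr : 1 ≤ r)
    (hc : 1 ≤ c) : ∃ P Q : RectSYT r c, ∀ k, ρ k = prom (stack P Q) r k := by
  classical
  have e : 2 * r * c = 2 * (r * c) := by ring
  set rk : Fin (2 * r * c) → ℕ × ℕ := fun x =>
    (chainRank (CrossRel ρ (r * c)) x - 1, chainRank (NestRel ρ (r * c)) x - 1) with hrk
  have hrk_mem : ∀ x : Fin (2 * r * c), (x : ℕ) < r * c → (rk x).1 < r ∧ (rk x).2 < c := by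
    intro x hx
    have h1 := chainRank_le (rel := CrossRel ρ (r * c)) (n := r * c)
      (fun A hA hA' => hcr _ ((hasCrossing_iff hρ).2 ⟨A, hA, hA', rfl⟩)) hx
    have h2 := chainRank_le (rel := NestRel ρ (r * c)) (n := r * c)
      (fun A hA hA' => hne _ ((hasNesting_iff hρ).2 ⟨A, hA, hA', rfl⟩)) hx
    have h3 := chainRank_pos (CrossRel ρ (r * c)) x
    have h4 := chainRank_pos (NestRel ρ (r * c)) x
    rw [hrk]
    constructor <;> dsimp only <;> omega
  have hrk_cross : ∀ x y, CrossRel ρ (r * c) x y → (rk x).1 < (rk y).1 := by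
    intro x y hxy
    have h1 := chainRank_lt_of_rel CrossRel.trans (fun _ _ h => h.1) hxy
    have h2 := chainRank_pos (CrossRel ρ (r * c)) x
    rw [hrk]
    dsimp only
    omega
  have hrk_nest : ∀ x y, NestRel ρ (r * c) x y → (rk x).2 < (rk y).2 := by
    intro x y hxy
    have h1 := chainRank_lt_of_rel NestRel.trans (fun _ _ h => h.1) hxy
    have h2 := chainRank_pos (NestRel ρ (r * c)) x
    rw [hrk]
    dsimp only
    omega
  have hdich : ∀ x y : Fin (2 * r * c), x < y → (y : ℕ) < r * c →
      CrossRel ρ (r * c) x y ∨ NestRel ρ (r * c) x y := by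
    intro x y hxy hy
    rcases lt_trichotomy (ρ x) (ρ y) with h | h | h
    · exact Or.inl ⟨hxy, h, hy⟩
    · exact absurd (ρ.injective h) hxy.ne
    · exact Or.inr ⟨hxy, h, hy⟩
  have hrk_inj : ∀ x y : Fin (2 * r * c), x < y → (y : ℕ) < r * c → rk x ≠ rk y := by
    intro x y hxy hy h
    rcases hdich x y hxy hy with h1 | h1
    · exact (hrk_cross x y h1).ne (congrArg Prod.fst h)
    · exact (hrk_nest x y h1).ne (congrArg Prod.snd h)
  have hop : ∀ i j, ∃ x : Fin (2 * r * c), i < r → j < c → (x : ℕ) < r * c ∧ rk x = (i, j) := by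
    intro i j
    by_cases hij : i < r ∧ j < c
    · have hsurj := Finset.surjOn_of_injOn_of_card_le
        (s := (Finset.range (r * c)).attach) (t := Finset.range r ×ˢ Finset.range c)
        (fun x => rk ⟨x.1, by have := Finset.mem_range.1 x.2; omega⟩)
        (fun x _ => by
          have := hrk_mem ⟨x.1, by have := Finset.mem_range.1 x.2; omega⟩ (Finset.mem_range.1 x.2)
          rw [Finset.mem_coe, Finset.mem_product, Finset.mem_range, Finset.mem_range]
          exact this)
        (fun x _ y _ h => by
          have hx := Finset.mem_range.1 x.2
          have hy := Finset.mem_range.1 y.2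
          rcases lt_trichotomy x.1 y.1 with h1 | h1 | h1
          · exact absurd h (hrk_inj _ _ (Fin.lt_def.2 h1) hy)
          · exact Subtype.ext h1
          · exact absurd h.symm (hrk_inj _ _ (Fin.lt_def.2 h1) hx))
        (by rw [Finset.card_product, Finset.card_attach, Finset.card_range, Finset.card_range,
          Finset.card_range])
      obtain ⟨x, -, hx⟩ := hsurj (show (i, j) ∈ ((Finset.range r ×ˢ Finset.range c : Finset _) :
        Set (ℕ × ℕ)) by simpa using hij)
      exact ⟨_, fun _ _ => ⟨Finset.mem_range.1 x.2, hx⟩⟩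
    · have : 0 < r * c := Nat.mul_pos hr hc
      exact ⟨⟨0, by omega⟩, fun h1 h2 => absurd ⟨h1, h2⟩ hij⟩
  choose op hop using hop
  have hop_nest : ∀ i < r, ∀ j j', j < j' → j' < c → NestRel ρ (r * c) (op i j) (op i j') := by
    intro i hi j j' hj hj'
    obtain ⟨h1, h2⟩ := hop i j hi (hj.trans hj')
    obtain ⟨h1', h2'⟩ := hop i j' hi hj'
    rcases lt_trichotomy (op i j) (op i j') with h | h | h
    · rcases hdich _ _ h h1' with h3 | h3
      · have := hrk_cross _ _ h3
        rw [h2, h2'] at this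
        exact absurd this (lt_irrefl _)
      · exact h3
    · rw [h, h2'] at h2
      exact absurd (congrArg Prod.snd h2) hj.ne'
    · rcases hdich _ _ h h1 with h3 | h3
      · have := hrk_cross _ _ h3
        rw [h2, h2'] at this
        exact absurd this (lt_irrefl _)
      · have := hrk_nest _ _ h3
        rw [h2, h2'] at this
        exact absurd this hj.not_gt
  have hop_cross : ∀ i i', i < i' → i' < r → ∀ j < c,
      CrossRel ρ (r * c) (op i j) (op i' j) := by
    intro i i' hi hi' j hj
    obtain ⟨h1, h2⟩ := hop i j (hi.trans hi') hj
    obtain ⟨h1', h2'⟩ := hop i' j hi' hj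
    rcases lt_trichotomy (op i j) (op i' j) with h | h | h
    · rcases hdich _ _ h h1' with h3 | h3
      · exact h3
      · have := hrk_nest _ _ h3
        rw [h2, h2'] at this
        exact absurd this (lt_irrefl _)
    · rw [h, h2'] at h2
      exact absurd (congrArg Prod.fst h2) hi.ne'
    · rcases hdich _ _ h h1 with h3 | h3
      · have := hrk_cross _ _ h3
        rw [h2, h2'] at this
        exact absurd this hi.not_gt
      · have := hrk_nest _ _ h3
        rw [h2, h2'] at this
        exact absurd this (lt_irrefl _)
  have hop_inj : ∀ i < r, ∀ j < c, ∀ i' < r, ∀ j' < c, op i j = op i' j' → (i, j) = (i', j') := by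
    intro i hi j hj i' hi' j' hj' h
    rw [← (hop i j hi hj).2, ← (hop i' j' hi' hj').2, h]
  have hρop : ∀ i < r, ∀ j < c, r * c ≤ (ρ (op i j) : ℕ) := fun i hi j hj => by
    have h1 := (hop i j hi hj).1
    have h2 := hρ (op i j)
    omega
  set P : RectSYT r c := rectSYTOfEntries (fun i j => (op i j : ℕ) + 1)
    (fun i hi j j' hj hj' => Nat.succ_lt_succ (hop_nest i hi j j' hj hj').1)
    (fun i i' hi hi' j hj => Nat.succ_lt_succ (hop_cross i i' hi hi' j hj).1)
    (fun i hi j hj => ⟨Nat.succ_pos _, (hop i j hi hj).1⟩)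
    (fun i hi j hj i' hi' j' hj' h =>
      hop_inj i hi j hj i' hi' j' hj' (Fin.ext (Nat.succ_injective h))) with hP
  set Q : RectSYT r c := rectSYTOfEntries (fun i j => (ρ (op i (c - 1 - j)) : ℕ) - r * c + 1)
    (fun i hi j j' hj hj' => by
      have h1 := (hop_nest i hi (c - 1 - j') (c - 1 - j) (by omega) (by omega)).2.1
      have h2 := hρop i hi (c - 1 - j) (by omega)
      have h3 := hρop i hi (c - 1 - j') (by omega)
      rw [Fin.lt_def] at h1
      omega)
    (fun i i' hi hi' j hj => by
      have h1 := (hop_cross i i' hi hi' (c - 1 - j) (by omega)).2.1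
      have h2 := hρop i (by omega) (c - 1 - j) (by omega)
      rw [Fin.lt_def] at h1
      omega)
    (fun i hi j hj => ⟨Nat.succ_pos _, by
      have h1 := (ρ (op i (c - 1 - j))).2
      have h2 : 0 < r * c := Nat.mul_pos hr hc
      omega⟩)
    (fun i hi j hj i' hi' j' hj' h => by
      have h1 := hρop i hi (c - 1 - j) (by omega)
      have h2 := hρop i' hi' (c - 1 - j') (by omega)
      have h3 := hop_inj i hi (c - 1 - j) (by omega) i' hi' (c - 1 - j') (by omega)
        (ρ.injective (Fin.ext (by omega)))
      rw [Prod.mk.injEq] at h3 ⊢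
      omega) with hQ
  have hF := isStackedFilling_stack P Q
  have hPe : ∀ i < r, ∀ j < c, (stack P Q).entry i j = op i j + 1 := by
    intro i hi j hj
    change stackEntry P Q i j = _
    rw [stackEntry_top _ _ hi]
    exact if_pos ⟨hi, hj⟩
  have hQe : ∀ i < r, ∀ j < c, (stack P Q).entry (r + i) j = ρ (op i (c - 1 - j)) + 1 := by
    intro i hi j hj
    change stackEntry P Q (r + i) j = _
    rw [stackEntry_bot _ _ (by omega) (by omega) hj, Nat.add_sub_cancel_left]
    have h1 : Q.entry i j = (ρ (op i (c - 1 - j)) : ℕ) - r * c + 1 := if_pos ⟨hi, hj⟩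
    have h2 := hρop i hi (c - 1 - j) (by omega)
    omega
  have hlow : ∀ x : Fin (2 * r * c), (x : ℕ) < r * c → ρ x = prom (stack P Q) r x := by
    intro x hx
    rcases exists_entry_eq hF x with ⟨a, ha, b, hb, hxe, -⟩ | ⟨-, -, -, -, -, hx'⟩
    · have h1 := prom_of_entry_top hF hr hc ha hb hxe
      rw [hQe a ha _ (by omega), show c - 1 - (c - 1 - b) = b by omega] at h1
      rw [hPe a ha b hb] at hxe
      have h2 : op a b = x := Fin.ext (by omega)
      rw [h2] at h1
      exact Fin.ext (by omega)
    · exact absurd hx (not_lt.2 hx')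
  refine ⟨P, Q, fun x => ?_⟩
  rcases Nat.lt_or_ge (x : ℕ) (r * c) with hx | hx
  · exact hlow x hx
  · have h1 := hlow (ρ x) ((hρ x).2 hx)
    rw [hinv] at h1
    conv_rhs => rw [h1]
    exact (prom_involutive hF hr hc (ρ x)).symm

theorem corollary1p2 (r c : ℕ) (hr : 1 ≤ r) (hc : 1 ≤ c) :
    ∃ Φ : stackedSYT r c → Equiv.Perm (Fin (2 * r * c)),
      (∀ (S : stackedSYT r c) (k : Fin (2 * r * c)), Φ S k = prom S.1 r k) ∧
      Function.Injective Φ ∧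
      Set.range Φ = {ρ : Equiv.Perm (Fin (2 * r * c)) |
        IsFixedPointFreeInvolution ρ ∧
        (∀ a b : Fin (2 * r * c), ρ a = b → a < b → (a : ℕ) < r * c ∧ r * c ≤ (b : ℕ)) ∧
        crossingNumber ρ = r ∧
        nestingNumber ρ = c} := by
  have hS : ∀ S : stackedSYT r c, IsStackedFilling r c 0 S.1.entry := by
    rintro ⟨S, P, Q, rfl⟩
    exact isStackedFilling_stack P Q
  refine ⟨fun S => (prom_involutive (hS S) hr hc).toPerm, fun S k => rfl, fun S S' h => ?_, ?_⟩
  · exact Subtype.ext (eq_of_prom_eq (hS S) (hS S') hr hc fun k => DFunLike.congr_fun h k)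
  · ext ρ
    constructor
    · rintro ⟨S, rfl⟩
      have hlt := prom_lt_iff (hS S) hr hc
      obtain ⟨-, h1, h2⟩ := matching_stacked (hS S) hr hc
        (ρ := (prom_involutive (hS S) hr hc).toPerm) fun k => rfl
      refine ⟨⟨prom_involutive (hS S) hr hc, fun a ha => ?_⟩, fun a b hab hlt' => ?_, h1, h2⟩
      · have h3 := hlt a
        have h4 : prom S.1 r a = a := ha
        rw [h4] at h3
        omega
      · have h3 := hlt a
        have h4 : prom S.1 r a = b := hab
        rw [h4] at h3
        rw [Fin.lt_def] at hlt'
        omega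
    · rintro ⟨⟨hinv, hfix⟩, hblock, hcr, hne⟩
      have hρ : ∀ x, (ρ x : ℕ) < r * c ↔ r * c ≤ (x : ℕ) := by
        intro x
        rcases lt_trichotomy x (ρ x) with h | h | h
        · have := hblock x (ρ x) rfl h
          omega
        · exact absurd h.symm (hfix x)
        · have := hblock (ρ x) x (hinv x) h
          omega
      obtain ⟨P, Q, hPQ⟩ := exists_stack_of_matching hinv hρ
        (fun k hk => hcr ▸ le_csSup (bddAbove_hasCrossing ρ) hk)
        (fun k hk => hne ▸ le_csSup (bddAbove_hasNesting ρ) hk) hr hc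
      exact ⟨⟨stack P Q, P, Q, rfl⟩, Equiv.ext fun k => (hPQ k).symm⟩
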